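/- **Setting.** Let $\mathfrak g$ be the (finite-dimensional) complexified Lie algebra of a compact simply connected semisimple gauge group, $\mathfrak h$ a Cartan subalgebra, $R$ the root system, and $(\cdot,\cdot)$ a symmetric invariant bilinear form on $\mathfrak g$ which is a positive multiple of the Killing form on each simple component. For $\alpha\in R$ let $t_\alpha\in\mathfrak h$ be given by $(t_\alpha,X)=\alpha(X)$, $|\alpha|^2=(t_\alpha,t_\alpha)$, $h_\alpha=2t_\alpha/|\alpha|^2$. Let $W_0\in\mathfrak h$ be a regular $A_1$-vector: the element $e_0$ of an $\mathfrak{sl}(2)$-triple, lying in the open fundamental Weyl chamber of some base of $R$. Let $\alpha_1,\dots,\alpha_{\mathcal L}$ be the roots with $\alpha(W_0)=2$, $h_i=h_{\alpha_i}$, and put $$C_{ij}=\alpha_i(h_j),\qquad h_{ij}=(h_i,h_j),\qquad w_i=2\sum_j (C^{-1})_{ij}.$$ Let $k\in\{1,0,-1\}$, $\ell>0$. For real functions $m,S,\omega_i,\mathcal E_i$ of $r$ put $a_i=\sum_j(C^{-1})_{ij}\mathcal E_j$ and $$\mu=k-\frac{2m}{r}+\frac{r^2}{\ell^2},\quad P=\tfrac18\sum_{i,j}(kw_i-\omega_i^2)h_{ij}(kw_j-\omega_j^2),\quad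 G=\sum_i\frac{\omega_i'^2}{|\alpha_i|^2},$$ $$\zeta=\sum_i\frac{\mathcal E_i^2\omega_i^2}{|\alpha_i|^2},\quad \eta=\tfrac12\sum_{i,j}a_i'h_{ij}a_j',\quad \mathcal F_i=\frac{\omega_i}{2}\sum_jC_{ij}(kw_j-\omega_j^2),\quad \mathcal Z_i=\sum_jC_{ij}\mathcal E_j\omega_j^2 .$$ The field equations are $$m'=\frac{r^2\eta}{S^2}+\frac{\zeta}{\mu S^2}+\mu G+\frac{P}{r^2},\qquad \frac{S'}{S}=\frac{2G}{r}+\frac{2\zeta}{\mu^2S^2r},$$ $$0=\mathcal E_i''+\frac2r\Big(1-G-\frac{\zeta}{\mu^2S^2}\Big)\mathcal E_i'-\frac{\mathcal Z_i}{\mu r^2},$$ $$0=r^2\mu\,\omega_i''+2\Big(m-\frac Pr-\frac{r^3\eta}{S^2}+\frac{r^3}{\ell^2}\Big)\omega_i'+\frac{r^2\mathcal E_i^2\omega_i}{\mu S^2}+\mathcal F_i .$$ A solution on a set of radii is a tuple $(m,S,\omega_i,\mathcal E_i)$ with $m,S$ differentiable and $\omega_i,\mathcal E_i$ twice differentiable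 there, with $r,\mu,S\neq0$ there, satisfying these equations. Let $r_h\ne0$ and $\rho=r-r_h$. For initial values $p=(S_h,(\omega_{j,h}),(\mathcal E'_{j,h}))\in\mathbb R\times\mathbb R^{\mathcal L}\times\mathbb R^{\mathcal L}$ with $S_h\neq0$ put $$\mu'_h(p)=\frac{k}{r_h}+\frac{3r_h}{\ell^2}-\frac{2P_h}{r_h^3}-\frac{2r_h\eta_h}{S_h^2},\qquad(\ast)$$ where $P_h$, $\eta_h$ are $P$, $\eta$ evaluated at $\omega_j=\omega_{j,h}$, $\mathcal E_j'=\mathcal E_{j,h}'$. Consider the expansions $$\mu=\nu\rho+O(\rho^2),\quad S=S_h+O(\rho),\quad \omega_j=\omega_{j,h}+O(\rho),\quad \mathcal E_j=\mathcal E_{j,h}'\,\rho+O(\rho^2).\qquad(\ast\ast)$$ **Proposition.** (a) Let $p_0$ be arbitrary initial values with $S_h\ne0$ and $\mu'_h(p_0)>0$ (regular non-extremal horizon). There are an open neighbourhood $U$ of $p_0$, consisting of such initial values, an $\varepsilon>0$, and functions $m,S,\omega_j,\mathcal E_j$ of $(p,r)$, analytic on $U\times(r_h-\varepsilon,r_h+\varepsilon)$,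 such that for each $p\in U$ they form a solution for $0<|r-r_h|<\varepsilon$ and satisfy $(\ast\ast)$ as $\rho\to0$ with the initial values $p$ and $\nu=\mu'_h(p)$. This solution is unique: any solution on $(r_h,r_h+\delta)$ or on $(r_h-\delta,r_h)$, $\delta>0$, which satisfies $(\ast\ast)$ with the same $p$ and $\nu=\mu_h'(p)$ as $r\to r_h$ in that interval coincides with it at the radii of that interval with $|r-r_h|<\varepsilon$. (b) The slope is forced: if a solution on $(r_h,r_h+\delta)$ or on $(r_h-\delta,r_h)$ satisfies $(\ast\ast)$ as $r\to r_h$ with some initial values $p$, $S_h\neq0$, and some $\nu>0$, then $\nu=\mu_h'(p)$ as given by $(\ast)$. -/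

import Mathlib

open Set Filter Topology Asymptotics

namespace EYM

section LieData

variable {𝔤 : Type*} [LieRing 𝔤] [LieAlgebra ℂ 𝔤]

/-- An invariant inner product on the complexified gauge algebra `𝔤`: a symmetric, ad-invariant
bilinear form which on each simple component (minimal nonzero ideal) is a positive multiple of the
Killing form. -/
structure IsInvariantInnerProduct (B : LinearMap.BilinForm ℂ 𝔤) : Prop where
  symm : ∀ x y : 𝔤, B x y = B y x
  invariant : ∀ x y z : 𝔤, B ⁅x, y⁆ z = B x ⁅y, z⁆
  pos : ∀ I : LieIdeal ℂ 𝔤, IsAtom I →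
    ∃ c : ℝ, 0 < c ∧ ∀ x ∈ I, ∀ y ∈ I, B x y = (c : ℂ) * killingForm ℂ 𝔤 x y

variable [FiniteDimensional ℂ 𝔤] [LieAlgebra.IsSemisimple ℂ 𝔤]
variable {H : LieSubalgebra ℂ 𝔤} [H.IsCartanSubalgebra]

/-- `W₀` is the defining vector of an `𝔰𝔩(2)`-subalgebra of `𝔤` (an `A₁`-vector), and it lies in the
open fundamental Weyl chamber of the base `b`. -/
structure IsRegularA1Vector (b : (LieAlgebra.IsKilling.rootSystem H).Base) (W₀ : H) : Prop where
  chamber : ∀ α ∈ b.support, 0 < ((α : LieModule.Weight ℂ H 𝔤) W₀).re ∧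
    ((α : LieModule.Weight ℂ H 𝔤) W₀).im = 0
  isA1 : ∃ e f : 𝔤, IsSl2Triple (W₀ : 𝔤) e f

/-- The set `Σ_w` of the roots `α` with `α(W₀) = 2`; it indexes the gauge field functions. -/
abbrev SigmaW (W₀ : H) : Type _ := {α : H.root // (α : LieModule.Weight ℂ H 𝔤) W₀ = 2}

noncomputable instance (W₀ : H) : Fintype (SigmaW W₀) := Fintype.ofFinite _

noncomputable instance (W₀ : H) : DecidableEq (SigmaW W₀) := Classical.decEq _

/-- The vector `t_α ∈ H` determined by `(t_α, X) = α(X)` for all `X ∈ H`. -/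
noncomputable def dualVector (B : LinearMap.BilinForm ℂ 𝔤) (α : LieModule.Weight ℂ H 𝔤) : H :=
  Classical.epsilon fun t : H => ∀ X : H, B t X = α X

end LieData

/-- The constants in the reduced field equations: the Cartan matrix `C i j = ⟨α_i, α_j⟩ = α_i(h_j)`,
the Gram matrix `h i j = (h_i, h_j)` of the coroots, and the squared lengths `|α_i|²`. -/
structure Couplings (ι : Type*) where
  C : Matrix ι ι ℝ
  h : Matrix ι ι ℝ
  normSq : ι → ℝ

/-- The constants of the regular model given by `W₀` and the inner product `B`. -/
noncomputable def couplings {𝔤 : Type*} [LieRing 𝔤] [LieAlgebra ℂ 𝔤] [FiniteDimensional ℂ 𝔤]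
    [LieAlgebra.IsSemisimple ℂ 𝔤] {H : LieSubalgebra ℂ 𝔤} [H.IsCartanSubalgebra]
    (B : LinearMap.BilinForm ℂ 𝔤) (W₀ : H) : Couplings (SigmaW W₀) where
  C := fun α β => ((LieAlgebra.IsKilling.rootSystem H).pairingIn ℤ α.1 β.1 : ℝ)
  h := fun α β => (B (LieAlgebra.IsKilling.coroot (α.1 : LieModule.Weight ℂ H 𝔤))
    (LieAlgebra.IsKilling.coroot (β.1 : LieModule.Weight ℂ H 𝔤))).re
  normSq := fun α => (B (dualVector B (α.1 : LieModule.Weight ℂ H 𝔤))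
    (dualVector B (α.1 : LieModule.Weight ℂ H 𝔤))).re

section FieldEquations

variable {ι : Type*} [Fintype ι] [DecidableEq ι]

/-- `w_i = 2 ∑_j (C⁻¹)_{ij}`. -/
noncomputable def Couplings.w (c : Couplings ι) (i : ι) : ℝ := 2 * ∑ j, c.C⁻¹ i j

/-- `P = ⅛ ∑ (k w_i - ω_i²) h_{ij} (k w_j - ω_j²)`. -/
noncomputable def Couplings.P (c : Couplings ι) (k : ℝ) (ω : ι → ℝ) : ℝ :=
  1 / 8 * ∑ i, ∑ j, (k * c.w i - ω i ^ 2) * c.h i j * (k * c.w j - ω j ^ 2)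

/-- `G = ∑ ω_i'² / |α_i|²`, as a function of the derivatives `ω'`. -/
noncomputable def Couplings.G (c : Couplings ι) (dω : ι → ℝ) : ℝ :=
  ∑ i, dω i ^ 2 / c.normSq i

/-- `ζ = ∑ ℰ_i² ω_i² / |α_i|²`. -/
noncomputable def Couplings.zeta (c : Couplings ι) (ω E : ι → ℝ) : ℝ :=
  ∑ i, E i ^ 2 * ω i ^ 2 / c.normSq i

/-- `η = ½ ∑ a_i' h_{ij} a_j'` as a function of `ℰ'`, where `ℰ_i = ∑_j C_{ij} a_j`,
that is, `a' = C⁻¹ ℰ'`. -/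
noncomputable def Couplings.eta (c : Couplings ι) (dE : ι → ℝ) : ℝ :=
  1 / 2 * ∑ i, ∑ j, (c.C⁻¹.mulVec dE) i * c.h i j * (c.C⁻¹.mulVec dE) j

/-- `ℱ_i = ½ ω_i ∑_j C_{ij} (k w_j - ω_j²)`. -/
noncomputable def Couplings.F (c : Couplings ι) (k : ℝ) (ω : ι → ℝ) (i : ι) : ℝ :=
  ω i / 2 * ∑ j, c.C i j * (k * c.w j - ω j ^ 2)

/-- `𝒵_i = ∑_j C_{ij} ℰ_j ω_j²`. -/
noncomputable def Couplings.Z (c : Couplings ι) (ω E : ι → ℝ) (i : ι) : ℝ :=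
  ∑ j, c.C i j * E j * ω j ^ 2

/-- The field variables, as functions of the radius `r`. -/
structure Fields (ι : Type*) where
  m : ℝ → ℝ
  S : ℝ → ℝ
  ω : ι → ℝ → ℝ
  E : ι → ℝ → ℝ

/-- `μ = k - 2m/r + r²/ℓ²`. -/
noncomputable def Fields.mu {ι : Type*} (f : Fields ι) (k ℓ r : ℝ) : ℝ :=
  k - 2 * f.m r / r + r ^ 2 / ℓ ^ 2

/-- The static Einstein-Yang-Mills field equations at the radius `r`. The first five clauses say
that every term makes sense, the next two are the Einstein equations for `m` and `S`, the last two
the electric and the magnetic Yang-Mills equations. -/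
structure SolvesAt (c : Couplings ι) (k ℓ : ℝ) (f : Fields ι) (r : ℝ) : Prop where
  ne_zero : r ≠ 0 ∧ f.mu k ℓ r ≠ 0 ∧ f.S r ≠ 0
  diff_m : DifferentiableAt ℝ f.m r
  diff_S : DifferentiableAt ℝ f.S r
  diff_ω : ∀ i, DifferentiableAt ℝ (f.ω i) r ∧ DifferentiableAt ℝ (deriv (f.ω i)) r
  diff_E : ∀ i, DifferentiableAt ℝ (f.E i) r ∧ DifferentiableAt ℝ (deriv (f.E i)) r
  eq_m : deriv f.m r =
    r ^ 2 * c.eta (fun i => deriv (f.E i) r) / f.S r ^ 2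
      + c.zeta (fun i => f.ω i r) (fun i => f.E i r) / (f.mu k ℓ r * f.S r ^ 2)
      + f.mu k ℓ r * c.G (fun i => deriv (f.ω i) r)
      + c.P k (fun i => f.ω i r) / r ^ 2
  eq_S : deriv f.S r / f.S r =
    2 * c.G (fun i => deriv (f.ω i) r) / r
      + 2 * c.zeta (fun i => f.ω i r) (fun i => f.E i r) / (f.mu k ℓ r ^ 2 * f.S r ^ 2 * r)
  eq_E : ∀ i, 0 = deriv (deriv (f.E i)) r
      + 2 / r * (1 - c.G (fun j => deriv (f.ω j) r)
          - c.zeta (fun j => f.ω j r) (fun j => f.E j r) / (f.mu k ℓ r ^ 2 * f.S r ^ 2))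
        * deriv (f.E i) r
      - c.Z (fun j => f.ω j r) (fun j => f.E j r) i / (f.mu k ℓ r * r ^ 2)
  eq_ω : ∀ i, 0 = r ^ 2 * f.mu k ℓ r * deriv (deriv (f.ω i)) r
      + 2 * (f.m r - c.P k (fun j => f.ω j r) / r
          - r ^ 3 * c.eta (fun j => deriv (f.E j) r) / f.S r ^ 2 + r ^ 3 / ℓ ^ 2)
        * deriv (f.ω i) r
      + r ^ 2 * f.E i r ^ 2 * f.ω i r / (f.mu k ℓ r * f.S r ^ 2)
      + c.F k (fun j => f.ω j r) i

/-- The initial values `(S_h, (ω_{j,h})_j, (ℰ'_{j,h})_j)` at the horizon. -/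
abbrev HorizonData (ι : Type*) : Type _ := ℝ × (ι → ℝ) × (ι → ℝ)

/-- `μ'_h = k/r_h + 3r_h/ℓ² - 2P_h/r_h³ - 2 r_h η_h/S_h²`. -/
noncomputable def muPrime (c : Couplings ι) (k ℓ rh : ℝ) (p : HorizonData ι) : ℝ :=
  k / rh + 3 * rh / ℓ ^ 2 - 2 * c.P k p.2.1 / rh ^ 3 - 2 * rh * c.eta p.2.2 / p.1 ^ 2

/-- Initial values of a regular non-extremal horizon: `S_h ≠ 0` and `μ'_h > 0`. -/
def Admissible (c : Couplings ι) (k ℓ rh : ℝ) : Set (HorizonData ι) :=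
  {p | p.1 ≠ 0 ∧ 0 < muPrime c k ℓ rh p}

/-- The expansions at the horizon, with `ρ = r - r_h`, as `r → r_h` along the filter `l`:
`μ = ν ρ + O(ρ²)`, `S = S_h + O(ρ)`, `ω_j = ω_{j,h} + O(ρ)`, `ℰ_j = ℰ'_{j,h} ρ + O(ρ²)`. -/
structure HorizonExpansion {ι : Type*} (k ℓ rh : ℝ) (f : Fields ι) (p : HorizonData ι) (ν : ℝ)
    (l : Filter ℝ) : Prop where
  mu : (fun r => f.mu k ℓ r - ν * (r - rh)) =O[l] fun r => (r - rh) ^ 2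
  S : (fun r => f.S r - p.1) =O[l] fun r => r - rh
  ω : ∀ j, (fun r => f.ω j r - p.2.1 j) =O[l] fun r => r - rh
  E : ∀ j, (fun r => f.E j r - p.2.2 j * (r - rh)) =O[l] fun r => (r - rh) ^ 2

/-- `s` is a one-sided neighbourhood of the horizon: its exterior side `(r_h, r_h + δ)` or its
interior side `(r_h - δ, r_h)`. -/
def IsHorizonSide (rh : ℝ) (s : Set ℝ) : Prop :=
  ∃ δ : ℝ, 0 < δ ∧ (s = Ioo rh (rh + δ) ∨ s = Ioo (rh - δ) rh)

end FieldEquations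

end EYM

/-!
The horizon is a Fuchsian singularity of the field equations at `ρ = r - r_h = 0`, and the claims
hold for arbitrary constants (`Couplings`) in these equations.

Write the equation for `S` as `S'/S = (2/r)(G + ζ/(μ²S²))`. It turns both Yang-Mills equations into
divergence form, `(r² ℰ'/S)' = 𝒵/(μ S)` and `(μ S ω')' = -S (ℰ² ω/(μ S²) + ℱ/r²)` (`FirstOrderAt`,
equivalent to `SolvesAt`). In the regular unknowns `x = (S, ω, r² ℰ'/S)` and the singular unknowns
`y = (ℰ/ρ, μ/ρ, μ S ω'/ρ)` the field equations are then the system `x' = F₁(ρ, x, y)`,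
`(ρ y)' = F₂(ρ, x, y)`, where `F` is rational and `F₂(0, x, y) = ψ(x)` does not depend on `y`
(`Couplings.horizonRHS`).

*Existence and analyticity* (`exists_analytic_fuchsian`). On a segment `ρ = λ t`, `t ∈ [0, 1]`, the
system with `x(0) = ξ` is the fixed point equation `x = ξ + λ t A[F₁]`, `y = A[F₂]` in
`C([0, 1], X × Y)`, with `A f(t) = ∫₀¹ f(t s) ds`. The superposition operator of `F` is analytic at
constant functions (`analyticAt_superpose`), so the equation is analytic in `(ξ, λ)` and in the
unknown.
At `λ = 0` the operator is `(x, y) ↦ (ξ, A[ψ(x)])`, whose square is constant; hence its derivative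
`N` satisfies `N² = 0`, `1 - N` is invertible, and the analytic implicit function theorem gives a
solution analytic in `(ξ, λ)` (`exists_analytic_fixedPoint`). By invariance under scaling its value
at `t = 1`, as a function of `λ`, is the solution as a function of the radius.

*Uniqueness.* For another continuous solution on an interval `J` containing `0`, the set of the
`λ ∈ J` for which the two solutions agree on the segment from `0` to `λ` is closed, contains `0`,
and is open by the local uniqueness in the implicit function theorem.

*Regularity and the slope* (`HorizonExpansion.tendsto_curve`). A solution which only satisfies the
expansions extends continuously to the horizon. Indeed `r² ℰ'/S` has a convergent derivative, hence
converges, and its limit is fixed by that of `ℰ/ρ`. Likewise `μ S ω'` converges to some `a`; if `a`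
were not zero, `ω` would be logarithmic in `ρ`, so `a = 0` and `μ S ω'/ρ` converges. Then `μ'`
converges to `μ'_h(p)`, which must be the slope `ν`. This is the second claim, and it is what the
uniqueness argument needs at `λ = 0`.
-/

namespace EYM

/-! ### Superposition operators and fixed points depending analytically on parameters -/

section Superposition

/-- The superposition operator `f ↦ F ∘ f` between spaces of continuous functions. Since `F` need
not be continuous, it takes the value `0` where `F ∘ f` is discontinuous. -/
noncomputable def superpose {K E G : Type*} [TopologicalSpace K]
    [NormedAddCommGroup E] [NormedAddCommGroup G] (F : E → G) (f : C(K, E)) : C(K, G) :=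
  open Classical in if h : Continuous (fun t => F (f t)) then ⟨fun t => F (f t), h⟩ else 0

lemma superpose_apply {K E G : Type*} [TopologicalSpace K]
    [NormedAddCommGroup E] [NormedAddCommGroup G] {F : E → G} {f : C(K, E)}
    (h : Continuous fun t => F (f t)) (t : K) :
    superpose F f t = F (f t) := by
  simp [superpose, h]

lemma eventually_forall_mem_of_mem_nhds {K E : Type*} [TopologicalSpace K] [CompactSpace K]
    [NormedAddCommGroup E] {z : E} {O : Set E} (hO : O ∈ 𝓝 z) :
    ∀ᶠ f in 𝓝 (ContinuousMap.const K z), ∀ t, f t ∈ O := by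
  obtain ⟨r, hr, hrO⟩ := Metric.mem_nhds_iff.1 hO
  filter_upwards [Metric.ball_mem_nhds _ hr] with f hf t
  exact hrO ((ContinuousMap.dist_apply_le_dist t).trans_lt hf)

variable {K E G : Type*} [TopologicalSpace K] [CompactSpace K]
  [NormedAddCommGroup E] [NormedSpace ℝ E] [NormedAddCommGroup G] [NormedSpace ℝ G]

lemma update_apply_eq {α K E : Type*} [DecidableEq α] [TopologicalSpace K] [TopologicalSpace E]
    (m : α → C(K, E)) (i : α) (x : C(K, E)) (t : K) :
    (fun j => Function.update m i x j t) = Function.update (fun j => m j t) i (x t) := by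
  ext j
  by_cases hj : j = i
  · subst hj; simp
  · simp [hj]

/-- The pointwise application of a multilinear map to continuous functions. -/
noncomputable def pointwiseMultilinear (K : Type*) [TopologicalSpace K] [CompactSpace K] {n : ℕ}
    (p : ContinuousMultilinearMap ℝ (fun _ : Fin n => E) G) :
    ContinuousMultilinearMap ℝ (fun _ : Fin n => C(K, E)) C(K, G) :=
  MultilinearMap.mkContinuous
    { toFun := fun f => ⟨fun t => p fun i => f i t, by fun_prop⟩
      map_update_add' := by
        intro _ m i x y
        ext t
        simp [update_apply_eq]
      map_update_smul' := by
        intro _ m i a x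
        ext t
        simp [update_apply_eq] }
    ‖p‖ (by
      intro f
      rw [ContinuousMap.norm_le _ (by positivity)]
      intro t
      refine (p.le_opNorm _).trans ?_
      gcongr with i
      exact (f i).norm_coe_le_norm t)

lemma norm_pointwiseMultilinear_le {n : ℕ}
    (p : ContinuousMultilinearMap ℝ (fun _ : Fin n => E) G) : ‖pointwiseMultilinear K p‖ ≤ ‖p‖ :=
  MultilinearMap.mkContinuous_norm_le _ (norm_nonneg _) _

/-- The superposition operator of a function which is analytic at `z` is analytic at the constant
function `z`: its power series is the pointwise application of that of the function. -/
theorem analyticAt_superpose [CompleteSpace G] {F : E → G} {z : E} (hF : AnalyticAt ℝ F z) :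
    AnalyticAt ℝ (superpose F : C(K, E) → C(K, G)) (ContinuousMap.const K z) := by
  obtain ⟨p, r, hp⟩ := hF
  let q : FormalMultilinearSeries ℝ C(K, E) C(K, G) := fun n => pointwiseMultilinear K (p n)
  have hq : ∀ n, ‖q n‖ ≤ ‖p n‖ := fun n => norm_pointwiseMultilinear_le _
  refine ⟨q, r, hp.r_le.trans (FormalMultilinearSeries.radius_le_of_le hq), hp.r_pos, ?_⟩
  intro f hf
  have hft : ∀ t, f t ∈ Metric.eball (0 : E) r := by
    intro t
    rw [mem_eball_zero_iff] at hf ⊢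
    refine lt_of_le_of_lt ?_ hf
    exact ENNReal.coe_le_coe.2 (f.norm_coe_le_norm t)
  have hcont : Continuous fun t => F ((ContinuousMap.const K z + f) t) := by
    refine continuous_iff_continuousAt.2 fun t => ?_
    have h1 : ContinuousAt F ((ContinuousMap.const K z + f) t) := by
      refine (hp.continuousOn).continuousAt (Metric.isOpen_eball.mem_nhds ?_)
      have := hft t
      rw [mem_eball_zero_iff] at this
      simpa [Metric.mem_eball, edist_eq_enorm_sub] using this
    exact ContinuousAt.comp (f := (ContinuousMap.const K z + f)) h1
      (ContinuousMap.const K z + f).continuous.continuousAt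
  have hsum : Summable fun n => q n fun _ => f := by
    have hrad : (‖f‖₊ : ENNReal) < p.radius := by
      rw [mem_eball_zero_iff] at hf
      exact hf.trans_le hp.r_le
    refine Summable.of_norm_bounded (p.summable_norm_mul_pow hrad) fun n => ?_
    refine ((q n).le_opNorm _).trans ?_
    simp only [Finset.prod_const, Finset.card_univ, Fintype.card_fin, coe_nnnorm]
    gcongr
    exact hq n
  suffices h : superpose F (ContinuousMap.const K z + f) = ∑' n, q n fun _ => f by
    rw [h]
    exact hsum.hasSum
  ext t
  rw [superpose_apply hcont]
  have h1 := hsum.hasSum.map (ContinuousMap.evalCLM ℝ t : C(K, G) →L[ℝ] G)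
    (ContinuousMap.evalCLM ℝ t : C(K, G) →L[ℝ] G).continuous
  exact (hp.hasSum (hft t)).unique h1

end Superposition

section FixedPoint

variable {Q B : Type*} [NormedAddCommGroup Q] [NormedSpace ℝ Q] [CompleteSpace Q]
  [NormedAddCommGroup B] [NormedSpace ℝ B] [CompleteSpace B]

/-- Analytic dependence of a fixed point on parameters. The hypothesis `hTT` makes the derivative of
`T (q, ·)` square to zero, so that the implicit function theorem applies to `b - T (q, b) = 0`. -/
theorem exists_analytic_fixedPoint {T : Q × B → B} {q : Q} {b : B} (hT : AnalyticAt ℝ T (q, b))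
    (hfix : T (q, b) = b) (hTT : ∀ᶠ b' in 𝓝 b, T (q, T (q, b')) = b) :
    ∃ φ : Q → B, AnalyticAt ℝ φ q ∧ φ q = b ∧
      ∀ᶠ v : Q × B in 𝓝 (q, b), T v = v.2 ↔ φ v.1 = v.2 := by
  let f : Q × B → B := fun v => v.2 - T v
  have hTc : ContDiffAt ℝ ⊤ T (q, b) := hT.contDiffAt
  have hf : ContDiffAt ℝ ⊤ f (q, b) := contDiffAt_snd.sub hTc
  have hTd : HasFDerivAt T (fderiv ℝ T (q, b)) (q, b) := hT.differentiableAt.hasFDerivAt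
  set N : B →L[ℝ] B := fderiv ℝ T (q, b) ∘L .inr ℝ Q B with hN
  have hTq : HasFDerivAt (fun b' => T (q, b')) N b :=
    HasFDerivAt.comp b (f := fun b' : B => (q, b')) hTd (hasFDerivAt_prodMk_right q b)
  have hTq' : HasFDerivAt (fun b' => T (q, b')) N (T (q, b)) := by rwa [hfix]
  have hNN : N * N = 0 := by
    have h1 : HasFDerivAt (fun b' => T (q, T (q, b'))) (N ∘L N) b :=
      HasFDerivAt.comp b (f := fun b' => T (q, b')) hTq' hTq
    have h2 : HasFDerivAt (fun b' => T (q, T (q, b'))) (0 : B →L[ℝ] B) b :=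
      (hasFDerivAt_const b b).congr_of_eventuallyEq hTT
    exact h1.unique h2
  have hfd : fderiv ℝ f (q, b) ∘L .inr ℝ Q B = 1 - N := by
    have h1 : fderiv ℝ f (q, b) = .snd ℝ Q B - fderiv ℝ T (q, b) :=
      (hasFDerivAt_snd.sub hTd).fderiv
    rw [h1, ContinuousLinearMap.sub_comp, hN]
    rfl
  have hinv : (fderiv ℝ f (q, b) ∘L .inr ℝ Q B).IsInvertible := by
    rw [hfd]
    refine ContinuousLinearMap.IsInvertible.of_inverse (g := 1 + N) ?_ ?_
    · change (1 - N) * (1 + N) = 1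
      simp [mul_add, sub_mul, hNN]
    · change (1 + N) * (1 - N) = 1
      simp [add_mul, mul_sub, hNN]
  have hf0 : f (q, b) = 0 := by simp [f, hfix]
  refine ⟨hf.implicitFunction (by simp) hinv, ?_, hf.implicitFunction_apply_self _ hinv, ?_⟩
  · have := hf.contDiffAt_implicitFunction (by simp) hinv
    exact this.analyticAt
  · filter_upwards [hf.eventually_apply_eq_iff_implicitFunction (by simp) hinv] with v hv
    rw [← hv, hf0]
    simp only [f, sub_eq_zero]
    exact eq_comm

end FixedPoint

/-! ### The integral operator of a Fuchsian system -/

section Average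

open scoped unitInterval

lemma integrable_unitInterval {E : Type*} [NormedAddCommGroup E] {f : I → E} (hf : Continuous f) :
    MeasureTheory.Integrable f :=
  hf.integrable_of_hasCompactSupport (HasCompactSupport.of_compactSpace f)

variable {E : Type*} [NormedAddCommGroup E] [NormedSpace ℝ E]

lemma continuous_integral_mul (f : C(I, E)) : Continuous fun t : I => ∫ s : I, f (t * s) := by
  have h : Continuous (Function.uncurry fun t s : I => f (t * s)) := by
    unfold Function.uncurry; fun_prop
  simpa using continuous_parametric_integral_of_continuous
    (μ := (MeasureTheory.volume : MeasureTheory.Measure I)) h isCompact_univ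

/-- The averaging operator `f ↦ (t ↦ ∫₀¹ f (t s) ds)`. -/
noncomputable def average : C(I, E) →L[ℝ] C(I, E) :=
  LinearMap.mkContinuous
    { toFun := fun f => ⟨fun t => ∫ s : I, f (t * s), continuous_integral_mul f⟩
      map_add' := by
        intro f g
        ext t
        exact MeasureTheory.integral_add (integrable_unitInterval (by fun_prop))
          (integrable_unitInterval (by fun_prop))
      map_smul' := by
        intro c f
        ext t
        exact MeasureTheory.integral_smul c _ } 1 (by
    intro f
    rw [one_mul, ContinuousMap.norm_le _ (norm_nonneg _)]
    intro t
    refine (MeasureTheory.norm_integral_le_of_norm_le_const (C := ‖f‖)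
      (Eventually.of_forall fun s => f.norm_coe_le_norm _)).trans ?_
    simp)

lemma analyticAt_average (f : C(I, E)) : AnalyticAt ℝ (average : C(I, E) → C(I, E)) f :=
  ContinuousLinearMap.analyticAt (average : C(I, E) →L[ℝ] C(I, E)) f

lemma average_apply (f : C(I, E)) (t : I) : average f t = ∫ s : I, f (t * s) := rfl

/-- Multiplication by the variable `t`. -/
noncomputable def mulVar : C(I, E) →L[ℝ] C(I, E) :=
  LinearMap.mkContinuous
    { toFun := fun f => ⟨fun t => (t : ℝ) • f t, by fun_prop⟩
      map_add' := by intro f g; ext t; simp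
      map_smul' := by intro c f; ext t; exact smul_comm _ _ _ } 1 (by
    intro f
    rw [one_mul, ContinuousMap.norm_le _ (norm_nonneg _)]
    intro t
    have h1 : ‖(t : ℝ)‖ ≤ 1 := by
      rw [Real.norm_of_nonneg t.2.1]; exact t.2.2
    calc ‖(t : ℝ) • f t‖ = ‖(t : ℝ)‖ * ‖f t‖ := norm_smul _ _
      _ ≤ 1 * ‖f‖ := by gcongr; exact f.norm_coe_le_norm t
      _ = ‖f‖ := one_mul _)

lemma analyticAt_mulVar (f : C(I, E)) : AnalyticAt ℝ (mulVar : C(I, E) → C(I, E)) f :=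
  ContinuousLinearMap.analyticAt (mulVar : C(I, E) →L[ℝ] C(I, E)) f

lemma mulVar_apply (f : C(I, E)) (t : I) : mulVar f t = (t : ℝ) • f t := rfl

lemma integral_unitInterval (h : ℝ → E) : ∫ s : I, h s = ∫ s in (0 : ℝ)..1, h s := by
  rw [intervalIntegral.integral_of_le zero_le_one, ← MeasureTheory.integral_Icc_eq_integral_Ioc]
  exact MeasureTheory.integral_subtype_comap measurableSet_Icc h

lemma smul_integral_unitInterval (h : ℝ → E) (ρ : ℝ) :
    ρ • ∫ s : I, h (ρ * s) = ∫ s in (0 : ℝ)..ρ, h s := by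
  rw [integral_unitInterval (fun s => h (ρ * s)), intervalIntegral.smul_integral_comp_mul_left]
  simp

end Average

section Fuchs

open scoped unitInterval

variable {X Y : Type*} [NormedAddCommGroup X] [NormedSpace ℝ X]
  [NormedAddCommGroup Y] [NormedSpace ℝ Y]

/-- The path `t ↦ (lam t, z t)`. -/
noncomputable def scaledPath (v : ℝ × C(I, X × Y)) : C(I, ℝ × X × Y) :=
  ⟨fun t => (v.1 * t, v.2 t), by fun_prop⟩

lemma analyticAt_continuousLinearMap {E G : Type*} [NormedAddCommGroup E] [NormedSpace ℝ E]
    [NormedAddCommGroup G] [NormedSpace ℝ G] (L : E →L[ℝ] G) (v : E) : AnalyticAt ℝ L v :=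
  L.analyticAt v

lemma analyticAt_scaledPath (v : ℝ × C(I, X × Y)) :
    AnalyticAt ℝ (scaledPath : ℝ × C(I, X × Y) → C(I, ℝ × X × Y)) v := by
  let e : C(I, ℝ × X × Y) := ⟨fun t => ((t : ℝ), 0), by fun_prop⟩
  let L : C(I, X × Y) →L[ℝ] C(I, ℝ × X × Y) :=
    (ContinuousLinearMap.inr ℝ ℝ (X × Y)).compLeftContinuous ℝ I
  have h : (scaledPath : ℝ × C(I, X × Y) → C(I, ℝ × X × Y)) = fun v => v.1 • e + L v.2 := by
    ext v t <;> simp [scaledPath, e, L]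
  rw [h]
  exact (analyticAt_fst.smul analyticAt_const).add ((L.analyticAt _).comp analyticAt_snd)

/-- The integral operator of the Fuchsian system `x' = F₁(ρ, x, y)`, `(ρ y)' = F₂(ρ, x, y)`,
`x(0) = ξ`, on the segment `ρ = lam t`, `t ∈ [0, 1]`. The parameter is `(ξ, lam)`. -/
noncomputable def fuchsOp (F : ℝ × X × Y → X × Y) (v : (X × ℝ) × C(I, X × Y)) : C(I, X × Y) :=
  ContinuousMap.const I (v.1.1, (0 : Y))
    + v.1.2 • mulVar (((ContinuousLinearMap.inl ℝ X Y ∘L .fst ℝ X Y).compLeftContinuous ℝ I)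
        (average (superpose F (scaledPath (v.1.2, v.2)))))
    + ((ContinuousLinearMap.inr ℝ X Y ∘L .snd ℝ X Y).compLeftContinuous ℝ I)
        (average (superpose F (scaledPath (v.1.2, v.2))))

lemma fuchsOp_apply {F : ℝ × X × Y → X × Y} {ξ : X} {lam : ℝ} {z : C(I, X × Y)}
    (h : Continuous fun t : I => F (lam * t, z t)) (t : I) :
    fuchsOp F ((ξ, lam), z) t
      = (ξ + (lam * t) • (∫ s : I, F (lam * (t * s : I), z (t * s))).1,
          (∫ s : I, F (lam * (t * s : I), z (t * s))).2) := by
  have h1 : average (superpose F (scaledPath (lam, z))) t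
      = ∫ s : I, F (lam * (t * s : I), z (t * s)) := by
    rw [average_apply]
    congr 1
    ext1 s
    exact superpose_apply (f := scaledPath (lam, z)) h (t * s)
  ext <;> simp [fuchsOp, mulVar_apply, h1, mul_smul]

/-- The integral equation is invariant under a rescaling of the segment. -/
lemma fuchsOp_comp_mul {F : ℝ × X × Y → X × Y} {ξ : X} {lam : ℝ} {z z' : C(I, X × Y)}
    (h : Continuous fun t : I => F (lam * t, z t)) {s : I} (hz' : ∀ t, z' t = z (s * t)) (t : I) :
    fuchsOp F ((ξ, s * lam), z') t = fuchsOp F ((ξ, lam), z) (s * t) := by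
  have e : ∀ t : I, s * lam * t = lam * (s * t : I) := by
    intro t; rw [Set.Icc.coe_mul]; ring
  have h' : Continuous fun t : I => F (s * lam * t, z' t) := by
    have : Continuous fun t : I => F (lam * (s * t : I), z (s * t)) :=
      h.comp (g := fun t : I => F (lam * t, z t)) (f := fun t : I => s * t) (by fun_prop)
    simpa only [e, hz'] using this
  rw [fuchsOp_apply h', fuchsOp_apply h]
  simp only [e, hz', mul_assoc]

variable [CompleteSpace X] [CompleteSpace Y]

lemma analyticAt_fuchsOp {F : ℝ × X × Y → X × Y} {x : X} {y : Y}
    (hF : AnalyticAt ℝ F (0, x, y)) :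
    AnalyticAt ℝ (fuchsOp F) ((x, 0), ContinuousMap.const I (x, y)) := by
  have hpath : scaledPath (0, ContinuousMap.const I (x, y)) = ContinuousMap.const I (0, x, y) := by
    ext t <;> simp [scaledPath]
  have h0 : AnalyticAt ℝ (fun v : (X × ℝ) × C(I, X × Y) => v.1.2)
      ((x, 0), ContinuousMap.const I (x, y)) := AnalyticAt.fun_comp analyticAt_snd analyticAt_fst
  have h0' : AnalyticAt ℝ (fun v : (X × ℝ) × C(I, X × Y) => v.1.1)
      ((x, 0), ContinuousMap.const I (x, y)) := AnalyticAt.fun_comp analyticAt_fst analyticAt_fst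
  have h1 : AnalyticAt ℝ (fun v : (X × ℝ) × C(I, X × Y) => scaledPath (v.1.2, v.2))
      ((x, 0), ContinuousMap.const I (x, y)) :=
    AnalyticAt.comp (g := scaledPath) (f := fun v : (X × ℝ) × C(I, X × Y) => (v.1.2, v.2))
      (analyticAt_scaledPath _) (h0.prod analyticAt_snd)
  have h2 : AnalyticAt ℝ (fun v : (X × ℝ) × C(I, X × Y) =>
      average (superpose F (scaledPath (v.1.2, v.2))))
      ((x, 0), ContinuousMap.const I (x, y)) := by
    refine (analyticAt_average _).comp ?_
    refine AnalyticAt.comp (g := superpose F)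
      (f := fun v : (X × ℝ) × C(I, X × Y) => scaledPath (v.1.2, v.2)) ?_ h1
    dsimp only
    rw [hpath]
    exact analyticAt_superpose hF
  have h3 : AnalyticAt ℝ (fun v : (X × ℝ) × C(I, X × Y) =>
      ContinuousMap.const I (v.1.1, (0 : Y))) ((x, 0), ContinuousMap.const I (x, y)) :=
    AnalyticAt.comp (g := (ContinuousLinearMap.const ℝ I : X × Y →L[ℝ] C(I, X × Y)))
      (f := fun v : (X × ℝ) × C(I, X × Y) => (v.1.1, (0 : Y)))
      (analyticAt_continuousLinearMap _ _) (h0'.prod analyticAt_const)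
  refine (h3.add (h0.smul ?_)).add ?_
  · exact (analyticAt_mulVar _).comp
      ((analyticAt_continuousLinearMap _ _).comp h2)
  · exact (analyticAt_continuousLinearMap _ _).comp h2

/-- The value of the integral operator on a segment of a curve `z`, in terms of the primitive of
`h ρ = F (ρ, z ρ)`. -/
lemma fuchsOp_curve {F : ℝ × X × Y → X × Y} {ξ : X} {lam : ℝ} {g : C(I, X × Y)} {z : ℝ → X × Y}
    (hg : ∀ t : I, g t = z (lam * t)) (h : Continuous fun t : I => F (lam * t, z (lam * t)))
    (t : I) :
    (fuchsOp F ((ξ, lam), g) t).1 = ξ + (∫ s in (0 : ℝ)..lam * t, F (s, z s)).1 ∧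
    (lam * t) • (fuchsOp F ((ξ, lam), g) t).2 = (∫ s in (0 : ℝ)..lam * t, F (s, z s)).2 ∧
    (lam * t = 0 → (fuchsOp F ((ξ, lam), g) t).2 = (F (0, z 0)).2) := by
  have e : ∀ s : I, lam * (t * s : I) = lam * t * s := by
    intro s; rw [Set.Icc.coe_mul]; ring
  have h' : Continuous fun t : I => F (lam * t, g t) := by simpa only [hg] using h
  have h1 := fuchsOp_apply (ξ := ξ) h' t
  simp only [hg, e] at h1
  have h2 := smul_integral_unitInterval (fun ρ => F (ρ, z ρ)) (lam * t)
  refine ⟨?_, ?_, ?_⟩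
  · rw [h1, ← h2]; rfl
  · rw [h1, ← h2]; rfl
  · intro h0
    rw [h1, h0]
    simp

/-- Existence, analyticity and uniqueness for the Fuchsian system
`x' = F₁(ρ, x, y)`, `(ρ y)' = F₂(ρ, x, y)`, `x(0) = ξ`, whose singular part `F₂` does not depend on
`y` at `ρ = 0`. Evaluating at `t = 1` the solution of the integral equation on the segment `ρ t`,
`t ∈ [0, 1]`, turns analyticity in the parameter `ρ` into analyticity in the radius. -/
theorem exists_analytic_fuchsian {F : ℝ × X × Y → X × Y} {ψ : X → Y} {x₀ : X}
    (hF : AnalyticAt ℝ F (0, x₀, ψ x₀)) (hψ : ∀ x y, (F (0, x, y)).2 = ψ x)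
    {O : Set (ℝ × X × Y)} (hO : O ∈ 𝓝 (0, x₀, ψ x₀)) :
    ∃ U : Set X, IsOpen U ∧ x₀ ∈ U ∧ ∃ ε : ℝ, 0 < ε ∧ ∃ φ : X × ℝ → X × Y,
      AnalyticOnNhd ℝ φ (U ×ˢ Ioo (-ε) ε) ∧
      ∀ ξ ∈ U, φ (ξ, 0) = (ξ, ψ ξ) ∧
        (∀ ρ ∈ Ioo (-ε) ε, (ρ, φ (ξ, ρ)) ∈ O ∧
          HasDerivAt (fun ρ => (φ (ξ, ρ)).1) (F (ρ, φ (ξ, ρ))).1 ρ ∧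
          HasDerivAt (fun ρ => ρ • (φ (ξ, ρ)).2) (F (ρ, φ (ξ, ρ))).2 ρ) ∧
        ∀ J ⊆ Ioo (-ε) ε, J.OrdConnected → (0 : ℝ) ∈ J → ∀ z : ℝ → X × Y,
          ContinuousOn z J → z 0 = (ξ, ψ ξ) → ContinuousOn (fun ρ => F (ρ, z ρ)) J →
          (∀ ρ ∈ J, ρ ≠ 0 → HasDerivAt (fun ρ => (z ρ).1) (F (ρ, z ρ)).1 ρ ∧
            HasDerivAt (fun ρ => ρ • (z ρ).2) (F (ρ, z ρ)).2 ρ) →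
          ∀ ρ ∈ J, z ρ = φ (ξ, ρ) := by
  set b₀ : C(I, X × Y) := ContinuousMap.const I (x₀, ψ x₀) with hb₀
  set q₀ : X × ℝ := (x₀, 0) with hq₀
  set O' : Set (ℝ × X × Y) := {w | w ∈ O ∧ ContinuousAt F w} with hO'def
  have hO' : O' ∈ 𝓝 ((0 : ℝ), x₀, ψ x₀) :=
    Filter.Eventually.and hO (hF.eventually_analyticAt.mono fun w hw => hw.continuousAt)
  have hT : AnalyticAt ℝ (fuchsOp F) (q₀, b₀) := analyticAt_fuchsOp hF
  -- along paths close to the base point the right hand side is continuous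
  have hpath : ∀ᶠ v : (X × ℝ) × C(I, X × Y) in 𝓝 (q₀, b₀),
      ∀ t : I, (v.1.2 * (t : ℝ), v.2 t) ∈ O' := by
    have h1 : Tendsto (fun v : (X × ℝ) × C(I, X × Y) => scaledPath (v.1.2, v.2)) (𝓝 (q₀, b₀))
        (𝓝 (ContinuousMap.const I ((0 : ℝ), x₀, ψ x₀))) := by
      have h2 : ContinuousAt (scaledPath : ℝ × C(I, X × Y) → C(I, ℝ × X × Y)) (0, b₀) :=
        (analyticAt_scaledPath _).continuousAt
      have h3 : scaledPath ((0 : ℝ), b₀) = ContinuousMap.const I ((0 : ℝ), x₀, ψ x₀) := by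
        ext t <;> simp [scaledPath, hb₀]
      rw [← h3]
      exact h2.tendsto.comp (f := fun v : (X × ℝ) × C(I, X × Y) => (v.1.2, v.2))
        (Continuous.tendsto' (by fun_prop) _ _ (by simp [hq₀]))
    exact h1.eventually (eventually_forall_mem_of_mem_nhds hO')
  have hcontO : ∀ {lam : ℝ} {z : C(I, X × Y)}, (∀ t : I, (lam * (t : ℝ), z t) ∈ O') →
      Continuous fun t : I => F (lam * t, z t) := by
    intro lam z h
    refine continuous_iff_continuousAt.2 fun t => ?_
    exact ContinuousAt.comp (g := F) (f := fun t : I => (lam * (t : ℝ), z t)) (h t).2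
      (by fun_prop)
  -- at `lam = 0` the operator is explicit: applied twice, it forgets its argument
  have hT0 : ∀ {b : C(I, X × Y)}, (∀ t : I, (0 * (t : ℝ), b t) ∈ O') → ∀ t : I,
      fuchsOp F (q₀, b) t = (x₀, ∫ s : I, ψ (b (t * s)).1) := by
    intro b hb t
    have hint : MeasureTheory.Integrable
        fun s : I => F (0 * ((t * s : I) : ℝ), b (t * s)) :=
      integrable_unitInterval ((hcontO hb).comp
        (g := fun t : I => F (0 * (t : ℝ), b t)) (f := fun s : I => t * s) (by fun_prop))
    rw [hq₀, fuchsOp_apply (hcontO hb)]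
    refine Prod.ext (by simp) ?_
    simp only
    rw [snd_integral hint]
    refine MeasureTheory.integral_congr_ae (Eventually.of_forall fun s => ?_)
    simp only [zero_mul]
    exact hψ _ _
  have hb₀O : ∀ t : I, (0 * (t : ℝ), b₀ t) ∈ O' := by
    have := hpath.self_of_nhds
    simpa [hq₀] using this
  have hfix : fuchsOp F (q₀, b₀) = b₀ := by
    ext1 t
    rw [hT0 hb₀O]
    simp [hb₀]
  have hTT : ∀ᶠ b in 𝓝 b₀, fuchsOp F (q₀, fuchsOp F (q₀, b)) = b₀ := by
    have hc : Tendsto (fun b : C(I, X × Y) => (q₀, b)) (𝓝 b₀) (𝓝 (q₀, b₀)) :=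
      Continuous.tendsto' (by fun_prop) _ _ rfl
    have hTc : Tendsto (fun b => (q₀, fuchsOp F (q₀, b))) (𝓝 b₀) (𝓝 (q₀, b₀)) := by
      have := hT.continuousAt.tendsto.comp hc
      rw [hfix] at this
      exact tendsto_const_nhds.prodMk_nhds this
    filter_upwards [hc.eventually hpath, hTc.eventually hpath] with b h1 h2
    ext1 t
    rw [hT0 h2]
    simp [hT0 h1, hb₀]
  obtain ⟨Φ, hΦ, hΦ0, hΦiff⟩ := exists_analytic_fixedPoint hT hfix hTT
  obtain ⟨η, hη, hball⟩ := Metric.eventually_nhds_iff_ball.1 (hΦiff.and hpath)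
  have hΦball : ∀ᶠ q in 𝓝 q₀, Φ q ∈ Metric.ball b₀ η :=
    hΦ.continuousAt.eventually (by rw [hΦ0]; exact Metric.ball_mem_nhds _ hη)
  obtain ⟨η₁, hη₁, hball₁⟩ := Metric.eventually_nhds_iff_ball.1
    (hΦ.eventually_analyticAt.and (hΦball.and (Metric.ball_mem_nhds q₀ hη)))
  have hmem : ∀ {ξ : X} {lam : ℝ}, ξ ∈ Metric.ball x₀ η₁ → lam ∈ Ioo (-η₁) η₁ →
      (ξ, lam) ∈ Metric.ball q₀ η₁ := by
    intro ξ lam hξ hlam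
    rw [hq₀, ← ball_prod_same]
    exact ⟨hξ, by simpa [Real.ball_eq_Ioo] using hlam⟩
  have hprod : ∀ {q : X × ℝ} {b : C(I, X × Y)}, q ∈ Metric.ball q₀ η → b ∈ Metric.ball b₀ η →
      (q, b) ∈ Metric.ball (q₀, b₀) η := by
    intro q b hq hb
    rw [← ball_prod_same]
    exact ⟨hq, hb⟩
  -- the solution on a segment, its equation, and its invariance under scaling
  have hsolO : ∀ {ξ : X} {lam : ℝ}, ξ ∈ Metric.ball x₀ η₁ → lam ∈ Ioo (-η₁) η₁ →
      ∀ t : I, (lam * (t : ℝ), Φ (ξ, lam) t) ∈ O' := by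
    intro ξ lam hξ hlam
    have h1 := hball₁ _ (hmem hξ hlam)
    exact (hball _ (hprod h1.2.2 h1.2.1)).2
  have hsol : ∀ {ξ : X} {lam : ℝ}, ξ ∈ Metric.ball x₀ η₁ → lam ∈ Ioo (-η₁) η₁ →
      fuchsOp F ((ξ, lam), Φ (ξ, lam)) = Φ (ξ, lam) := by
    intro ξ lam hξ hlam
    have h1 := hball₁ _ (hmem hξ hlam)
    exact (hball _ (hprod h1.2.2 h1.2.1)).1.2 rfl
  have hscale : ∀ {ξ : X} {lam : ℝ}, ξ ∈ Metric.ball x₀ η₁ → lam ∈ Ioo (-η₁) η₁ → ∀ s : I,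
      Φ (ξ, s * lam) 1 = Φ (ξ, lam) s := by
    intro ξ lam hξ hlam s
    have hs : (s : ℝ) * lam ∈ Ioo (-η₁) η₁ := by
      rw [mem_Ioo, ← abs_lt] at hlam ⊢
      rw [abs_mul, abs_of_nonneg s.2.1]
      exact (mul_le_of_le_one_left (abs_nonneg _) s.2.2).trans_lt hlam
    let z' : C(I, X × Y) := (Φ (ξ, lam)).comp ⟨fun t => s * t, by fun_prop⟩
    have hz' : ∀ t, z' t = Φ (ξ, lam) (s * t) := fun t => rfl
    have h1 : fuchsOp F ((ξ, s * lam), z') = z' := by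
      ext1 t
      rw [fuchsOp_comp_mul (hcontO (hsolO hξ hlam)) hz', hsol hξ hlam, hz']
    have hb : z' ∈ Metric.ball b₀ η := by
      rw [Metric.mem_ball]
      refine lt_of_le_of_lt ?_ (hball₁ _ (hmem hξ hlam)).2.1
      rw [ContinuousMap.dist_le dist_nonneg]
      intro t
      exact ContinuousMap.dist_apply_le_dist (f := Φ (ξ, lam)) (g := b₀) (s * t)
    have h2 := (hball _ (hprod (hball₁ _ (hmem hξ hs)).2.2 hb)).1.1 h1
    rw [show Φ (ξ, s * lam) = z' from h2, hz', mul_one]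
  have hcurve : ∀ {ξ : X} {lam : ℝ}, ξ ∈ Metric.ball x₀ η₁ → lam ∈ Ioo (-η₁) η₁ → ∀ t : I,
      Φ (ξ, lam) t = Φ (ξ, lam * t) 1 := by
    intro ξ lam hξ hlam t
    rw [mul_comm, hscale hξ hlam]
  have han : AnalyticOnNhd ℝ (fun q => Φ q 1) (Metric.ball x₀ η₁ ×ˢ Ioo (-η₁) η₁) := by
    intro q hq
    have h1 := (hball₁ _ (hmem hq.1 hq.2)).1
    exact (analyticAt_continuousLinearMap
      (ContinuousMap.evalCLM ℝ (1 : I) : C(I, X × Y) →L[ℝ] X × Y) _).comp h1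
  refine ⟨Metric.ball x₀ η₁, Metric.isOpen_ball, Metric.mem_ball_self hη₁, η₁, hη₁,
    fun q => Φ q 1, han, ?_⟩
  intro ξ hξ
  have h0mem : (0 : ℝ) ∈ Ioo (-η₁) η₁ := by simp [hη₁]
  have hO1 : ∀ ρ ∈ Ioo (-η₁) η₁, (ρ, Φ (ξ, ρ) 1) ∈ O' := by
    intro ρ hρ
    simpa using hsolO hξ hρ 1
  have hcontΦ : ∀ ρ ∈ Ioo (-η₁) η₁, ContinuousAt (fun ρ => Φ (ξ, ρ) 1) ρ := by
    intro ρ hρ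
    exact ContinuousAt.comp (g := fun q => Φ q 1) (f := fun ρ : ℝ => (ξ, ρ))
      (han _ ⟨hξ, hρ⟩).continuousAt (by fun_prop)
  have hconth : ∀ ρ ∈ Ioo (-η₁) η₁, ContinuousAt (fun ρ => F (ρ, Φ (ξ, ρ) 1)) ρ := by
    intro ρ hρ
    exact ContinuousAt.comp (g := F) (f := fun ρ : ℝ => (ρ, Φ (ξ, ρ) 1)) (hO1 ρ hρ).2
      (continuousAt_id.prodMk (hcontΦ ρ hρ))
  have hform : ∀ ρ ∈ Ioo (-η₁) η₁,
      (Φ (ξ, ρ) 1).1 = ξ + (∫ s in (0 : ℝ)..ρ, F (s, Φ (ξ, s) 1)).1 ∧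
      ρ • (Φ (ξ, ρ) 1).2 = (∫ s in (0 : ℝ)..ρ, F (s, Φ (ξ, s) 1)).2 ∧
      (ρ = 0 → (Φ (ξ, ρ) 1).2 = (F (0, Φ (ξ, 0) 1)).2) := by
    intro ρ hρ
    have h1 : Continuous fun t : I => F (ρ * t, Φ (ξ, ρ * t) 1) := by
      have := hcontO (hsolO hξ hρ)
      simpa only [hcurve hξ hρ] using this
    have h2 := fuchsOp_curve (F := F) (ξ := ξ) (g := Φ (ξ, ρ)) (z := fun ρ => Φ (ξ, ρ) 1)
      (hcurve hξ hρ) h1 1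
    rw [hsol hξ hρ] at h2
    simpa using h2
  have hinit : Φ (ξ, 0) 1 = (ξ, ψ ξ) := by
    have h1 := hform 0 h0mem
    have h2 : (Φ (ξ, 0) 1).1 = ξ := by simpa using h1.1
    refine Prod.ext h2 ?_
    rw [h1.2.2 rfl]
    exact (hψ (Φ (ξ, 0) 1).1 (Φ (ξ, 0) 1).2).trans (by rw [h2])
  have hprim : ∀ ρ ∈ Ioo (-η₁) η₁, HasDerivAt
      (fun ρ => ∫ s in (0 : ℝ)..ρ, F (s, Φ (ξ, s) 1)) (F (ρ, Φ (ξ, ρ) 1)) ρ := by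
    intro ρ hρ
    have hc : ContinuousOn (fun ρ => F (ρ, Φ (ξ, ρ) 1)) (Ioo (-η₁) η₁) :=
      fun ρ hρ => (hconth ρ hρ).continuousWithinAt
    refine intervalIntegral.integral_hasDerivAt_right ?_ ?_ (hconth ρ hρ)
    · exact (hc.mono (ordConnected_Ioo.uIcc_subset h0mem hρ)).intervalIntegrable
    · exact hc.stronglyMeasurableAtFilter isOpen_Ioo ρ hρ
  refine ⟨hinit, fun ρ hρ => ⟨(hO1 ρ hρ).1, ?_, ?_⟩, ?_⟩
  · refine HasDerivAt.congr_of_eventuallyEq ((hprim ρ hρ).fst.const_add ξ) ?_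
    filter_upwards [isOpen_Ioo.mem_nhds hρ] with r hr using (hform r hr).1
  · refine HasDerivAt.congr_of_eventuallyEq (hprim ρ hρ).snd ?_
    filter_upwards [isOpen_Ioo.mem_nhds hρ] with r hr using (hform r hr).2.1
  -- uniqueness: the radii at which the two solutions agree form a set which is open, closed and
  -- contains `0`
  intro J hJ hJoc h0J z hz hz0 hFz hzd ρ₁ hρ₁
  have hJmul : ∀ (lam : J) (t : I), (lam : ℝ) * t ∈ J := by
    intro lam t
    have h1 : (lam : ℝ) * t ∈ uIcc (0 : ℝ) lam := by
      have := t.2.1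
      have := t.2.2
      rw [mem_uIcc]
      rcases le_total 0 (lam : ℝ) with h | h
      · left; constructor <;> nlinarith
      · right; constructor <;> nlinarith
    exact hJoc.uIcc_subset h0J lam.2 h1
  let g₂ : C(J × I, X × Y) := ⟨fun v => z (v.1 * v.2),
    hz.comp_continuous (f := fun v : J × I => (v.1 : ℝ) * v.2) (by fun_prop)
      fun v => hJmul v.1 v.2⟩
  let g : C(J, C(I, X × Y)) := g₂.curry
  have hg : ∀ (lam : J) (t : I), g lam t = z (lam * t) := fun lam t => rfl
  have hgT : ∀ lam : J, fuchsOp F ((ξ, (lam : ℝ)), g lam) = g lam := by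
    intro lam
    ext1 t
    have hc : Continuous fun t : I => F ((lam : ℝ) * t, z (lam * t)) :=
      hFz.comp_continuous (f := fun t : I => (lam : ℝ) * t) (by fun_prop) (hJmul lam)
    have h1 := fuchsOp_curve (F := F) (ξ := ξ) (g := g lam) (z := z) (hg lam) hc t
    have hsub : uIcc (0 : ℝ) (lam * t) ⊆ J := hJoc.uIcc_subset h0J (hJmul lam t)
    have hint : ∫ s in (0 : ℝ)..lam * t, F (s, z s)
        = ((z (lam * t)).1, (lam * t : ℝ) • (z (lam * t)).2)
          - ((z 0).1, (0 : ℝ) • (z 0).2) := by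
      refine intervalIntegral.integral_eq_sub_of_hasDeriv_right
        (f := fun ρ => ((z ρ).1, ρ • (z ρ).2)) ?_ ?_ (hFz.mono hsub).intervalIntegrable
      · have := hz.mono hsub
        exact this.fst.prodMk (continuousOn_id.smul this.snd)
      · intro x hx
        have hxJ : x ∈ J := hsub (Ioo_subset_Icc_self hx)
        have hx0 : x ≠ 0 := by
          rintro rfl
          rcases le_total 0 ((lam : ℝ) * t) with h | h
          · simp [h] at hx
          · simp [h] at hx
        have := (hzd x hxJ hx0)
        exact (this.1.prodMk this.2).hasDerivWithinAt
    rw [hint, hz0] at h1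
    refine Prod.ext ?_ ?_
    · rw [h1.1, hg]; simp
    · rw [hg]
      by_cases h0 : (lam : ℝ) * t = 0
      · rw [h1.2.2 h0, h0, hz0]
        exact hψ _ _
      · have := h1.2.1
        simp only [zero_smul, Prod.mk_sub_mk, sub_zero] at this
        exact smul_right_injective _ h0 this
  have hcΦ : Continuous fun lam : J => Φ (ξ, lam) := by
    refine continuous_iff_continuousAt.2 fun lam => ?_
    exact ContinuousAt.comp (g := Φ) (f := fun lam : J => (ξ, (lam : ℝ)))
      (hball₁ _ (hmem hξ (hJ lam.2))).1.continuousAt (by fun_prop)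
  have hclosed : IsClosed {lam : J | Φ (ξ, lam) = g lam} := isClosed_eq hcΦ g.continuous
  have hopen : IsOpen {lam : J | Φ (ξ, lam) = g lam} := by
    rw [isOpen_iff_mem_nhds]
    intro lam hlam
    have hb : g lam ∈ Metric.ball b₀ η := by
      rw [← (show Φ (ξ, lam) = g lam from hlam)]
      exact (hball₁ _ (hmem hξ (hJ lam.2))).2.1
    filter_upwards [g.continuous.continuousAt.preimage_mem_nhds
      (Metric.isOpen_ball.mem_nhds hb)] with lam' hlam'
    exact (hball _ (hprod (hball₁ _ (hmem hξ (hJ lam'.2))).2.2 hlam')).1.1 (hgT lam')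
  have : PreconnectedSpace J := Subtype.preconnectedSpace hJoc.isPreconnected
  have huniv := IsClopen.eq_univ ⟨hclosed, hopen⟩ ⟨⟨0, h0J⟩, by
    change Φ (ξ, 0) = g ⟨0, h0J⟩
    ext1 t
    rw [hg, hcurve hξ h0mem]
    simp [hinit, hz0]⟩
  have h1 : (⟨ρ₁, hρ₁⟩ : J) ∈ {lam : J | Φ (ξ, lam) = g lam} := huniv ▸ mem_univ _
  have h2 : Φ (ξ, ρ₁) = g ⟨ρ₁, hρ₁⟩ := h1
  simp only
  rw [h2, hg]
  simp

end Fuchs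

/-! ### The field equations in divergence form -/

section FirstOrder

lemma Fields.m_eq {ι : Type*} (f : Fields ι) (k ℓ : ℝ) {r : ℝ} (hr : r ≠ 0) :
    f.m r = r / 2 * (k - f.mu k ℓ r + r ^ 2 / ℓ ^ 2) := by
  unfold Fields.mu
  field_simp
  ring

variable {ι : Type*} [Fintype ι]

lemma Couplings.zeta_smul (c : Couplings ι) (ω e : ι → ℝ) (a : ℝ) :
    c.zeta ω (fun i => a * e i) = a ^ 2 * c.zeta ω e := by
  simp only [Couplings.zeta, Finset.mul_sum]
  exact Finset.sum_congr rfl fun i _ => by ring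

lemma Couplings.Z_smul (c : Couplings ι) (ω e : ι → ℝ) (a : ℝ) (i : ι) :
    c.Z ω (fun j => a * e j) i = a * c.Z ω e i := by
  simp only [Couplings.Z, Finset.mul_sum]
  exact Finset.sum_congr rfl fun j _ => by ring

lemma Couplings.contDiff_G (c : Couplings ι) : ContDiff ℝ ⊤ c.G := by
  unfold Couplings.G; fun_prop

lemma Couplings.contDiff_zeta (c : Couplings ι) :
    ContDiff ℝ ⊤ fun q : (ι → ℝ) × (ι → ℝ) => c.zeta q.1 q.2 := by
  unfold Couplings.zeta; fun_prop

lemma Couplings.contDiff_Z (c : Couplings ι) :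
    ContDiff ℝ ⊤ fun q : (ι → ℝ) × (ι → ℝ) => c.Z q.1 q.2 := by
  unfold Couplings.Z; fun_prop

variable [DecidableEq ι]

lemma Couplings.contDiff_P (c : Couplings ι) (k : ℝ) : ContDiff ℝ ⊤ (c.P k) := by
  unfold Couplings.P; fun_prop

lemma Couplings.contDiff_F (c : Couplings ι) (k : ℝ) : ContDiff ℝ ⊤ (c.F k) := by
  unfold Couplings.F; fun_prop

lemma Couplings.contDiff_eta (c : Couplings ι) : ContDiff ℝ ⊤ c.eta := by
  unfold Couplings.eta Matrix.mulVec dotProduct; fun_prop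

/-- The field equations in divergence form. The equation for `S` absorbs the friction terms of both
Yang-Mills equations, which become `(r² ℰ'/S)' = 𝒵/(μ S)` and
`(μ S ω')' = -S (ℰ² ω/(μ S²) + ℱ/r²)`. -/
structure FirstOrderAt (c : Couplings ι) (k ℓ : ℝ) (f : Fields ι) (r : ℝ) : Prop where
  ne_zero : r ≠ 0 ∧ f.mu k ℓ r ≠ 0 ∧ f.S r ≠ 0
  mu : HasDerivAt (f.mu k ℓ)
    ((k - f.mu k ℓ r) / r + 3 * r / ℓ ^ 2
      - 2 * r * c.eta (fun i => deriv (f.E i) r) / f.S r ^ 2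
      - 2 * c.zeta (fun i => f.ω i r) (fun i => f.E i r) / (r * f.mu k ℓ r * f.S r ^ 2)
      - 2 * f.mu k ℓ r * c.G (fun i => deriv (f.ω i) r) / r
      - 2 * c.P k (fun i => f.ω i r) / r ^ 3) r
  S : HasDerivAt f.S (f.S r * (2 / r) * (c.G (fun i => deriv (f.ω i) r)
    + c.zeta (fun i => f.ω i r) (fun i => f.E i r) / (f.mu k ℓ r ^ 2 * f.S r ^ 2))) r
  ω : ∀ i, DifferentiableAt ℝ (f.ω i) r ∧ DifferentiableAt ℝ (deriv (f.ω i)) r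
  E : ∀ i, DifferentiableAt ℝ (f.E i) r ∧ DifferentiableAt ℝ (deriv (f.E i)) r
  electric : ∀ i, HasDerivAt (fun r => r ^ 2 * deriv (f.E i) r / f.S r)
    (c.Z (fun j => f.ω j r) (fun j => f.E j r) i / (f.mu k ℓ r * f.S r)) r
  magnetic : ∀ i, HasDerivAt (fun r => f.mu k ℓ r * f.S r * deriv (f.ω i) r)
    (-f.S r * (f.E i r ^ 2 * f.ω i r / (f.mu k ℓ r * f.S r ^ 2)
      + c.F k (fun j => f.ω j r) i / r ^ 2)) r

theorem SolvesAt.firstOrderAt {c : Couplings ι} {k ℓ : ℝ} (hℓ : ℓ ≠ 0) {f : Fields ι} {r : ℝ}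
    (h : SolvesAt c k ℓ f r) : FirstOrderAt c k ℓ f r := by
  obtain ⟨hr, hμ, hS⟩ := h.ne_zero
  have hm := f.m_eq k ℓ hr
  have em := h.eq_m
  have eS := h.eq_S
  have eE := h.eq_E
  have eω := h.eq_ω
  have hdS : HasDerivAt f.S (f.S r * (2 / r) * (c.G (fun i => deriv (f.ω i) r)
      + c.zeta (fun i => f.ω i r) (fun i => f.E i r) / (f.mu k ℓ r ^ 2 * f.S r ^ 2))) r := by
    refine h.diff_S.hasDerivAt.congr_deriv ?_
    rw [div_eq_iff hS] at eS
    rw [eS]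
    field_simp
  have hdμ : HasDerivAt (f.mu k ℓ)
      ((k - f.mu k ℓ r) / r + 3 * r / ℓ ^ 2
        - 2 * r * c.eta (fun i => deriv (f.E i) r) / f.S r ^ 2
        - 2 * c.zeta (fun i => f.ω i r) (fun i => f.E i r) / (r * f.mu k ℓ r * f.S r ^ 2)
        - 2 * f.mu k ℓ r * c.G (fun i => deriv (f.ω i) r) / r
        - 2 * c.P k (fun i => f.ω i r) / r ^ 3) r := by
    have h1 : HasDerivAt (f.mu k ℓ)
        (-((2 * deriv f.m r * r - 2 * f.m r * 1) / r ^ 2) + (2 * r) / ℓ ^ 2) r := by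
      have h2 := ((((h.diff_m.hasDerivAt.const_mul 2).div (hasDerivAt_id r) hr).const_sub k).add
        ((hasDerivAt_pow 2 r).div_const (ℓ ^ 2)))
      refine h2.congr_deriv ?_
      simp
    refine h1.congr_deriv ?_
    rw [em, hm]
    field_simp
    ring
  refine ⟨h.ne_zero, hdμ, hdS, h.diff_ω, h.diff_E, fun i => ?_, fun i => ?_⟩
  · have h1 := ((hasDerivAt_pow 2 r).mul (h.diff_E i).2.hasDerivAt).div hdS hS
    refine h1.congr_deriv ?_
    have e := eE i
    simp only [Pi.mul_apply, Nat.cast_ofNat, Nat.add_one_sub_one, pow_one]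
    generalize c.G _ = G at *
    generalize c.zeta _ _ = ζ at *
    generalize c.Z _ _ i = Z at *
    have e2 : deriv (deriv (f.E i)) r = Z / (f.mu k ℓ r * r ^ 2)
        - 2 / r * (1 - G - ζ / (f.mu k ℓ r ^ 2 * f.S r ^ 2)) * deriv (f.E i) r := by linarith
    rw [e2]
    field_simp
    ring
  · have h1 := (hdμ.mul hdS).mul (h.diff_ω i).2.hasDerivAt
    refine h1.congr_deriv ?_
    have e := eω i
    rw [hm] at e
    simp only [Pi.mul_apply]
    generalize c.G _ = G at *
    generalize c.zeta _ _ = ζ at *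
    generalize c.eta _ = η at *
    generalize c.P _ _ = P at *
    generalize c.F _ _ i = F at *
    linear_combination (norm := (field_simp; ring)) -(f.S r / r ^ 2) * e

theorem FirstOrderAt.solvesAt {c : Couplings ι} {k ℓ : ℝ} (hℓ : ℓ ≠ 0) {f : Fields ι} {r : ℝ}
    (h : FirstOrderAt c k ℓ f r) : SolvesAt c k ℓ f r := by
  obtain ⟨hr, hμ, hS⟩ := h.ne_zero
  have hm := f.m_eq k ℓ hr
  have hmd := HasDerivAt.congr_of_eventuallyEq (f₁ := f.m) (((hasDerivAt_id r).div_const 2).mul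
      ((h.mu.const_sub k).add ((hasDerivAt_pow 2 r).div_const (ℓ ^ 2)))) (by
    filter_upwards [isOpen_ne.mem_nhds hr] with x hx
    simpa using f.m_eq k ℓ hx)
  refine ⟨h.ne_zero, hmd.differentiableAt, h.S.differentiableAt, h.ω, h.E, ?_, ?_,
    fun i => ?_, fun i => ?_⟩
  · rw [hmd.deriv]
    simp only [id_eq, Pi.add_apply, Nat.cast_ofNat, Nat.add_one_sub_one, pow_one]
    field_simp
    ring
  · rw [h.S.deriv]
    field_simp
  · have h1 := ((hasDerivAt_pow 2 r).mul (h.E i).2.hasDerivAt).div h.S hS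
    have e := h1.unique (h.electric i)
    simp only [Pi.mul_apply, Nat.cast_ofNat, Nat.add_one_sub_one, pow_one] at e
    generalize c.G _ = G at *
    generalize c.zeta _ _ = ζ at *
    generalize c.Z _ _ i = Z at *
    linear_combination (norm := (field_simp; ring)) -(f.S r / r ^ 2) * e
  · have h1 := (h.mu.mul h.S).mul (h.ω i).2.hasDerivAt
    have e := h1.unique (h.magnetic i)
    rw [hm]
    simp only [Pi.mul_apply] at e
    generalize c.G _ = G at *
    generalize c.zeta _ _ = ζ at *
    generalize c.eta _ = η at *
    generalize c.P _ _ = P at *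
    generalize c.F _ _ i = F at *
    linear_combination (norm := (field_simp; ring)) -(r ^ 2 / f.S r) * e

end FirstOrder

/-! ### The field equations as a Fuchsian system -/

/-- The unknowns `(ℰ_i/ρ, μ/ρ, μ S ω_i'/ρ)`, `ρ = r - r_h`, whose equations are singular at the
horizon. -/
abbrev SingularData (ι : Type*) : Type _ := (ι → ℝ) × ℝ × (ι → ℝ)

section HorizonSystem

variable {ι : Type*}

/-- The values of the regular unknowns at the horizon. -/
noncomputable def regularInit (rh : ℝ) (p : HorizonData ι) : HorizonData ι :=
  (p.1, p.2.1, fun i => rh ^ 2 * p.2.2 i / p.1)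

/-- The unknowns of the Fuchsian system made of the field variables. -/
noncomputable def Fields.curve (k ℓ rh : ℝ) (f : Fields ι) (r : ℝ) :
    HorizonData ι × SingularData ι :=
  ((f.S r, (fun i => f.ω i r), fun i => r ^ 2 * deriv (f.E i) r / f.S r),
   ((fun i => f.E i r / (r - rh)), f.mu k ℓ r / (r - rh),
    fun i => f.mu k ℓ r * f.S r * deriv (f.ω i) r / (r - rh)))

/-- The field variables made of the unknowns of the Fuchsian system. -/
noncomputable def Fields.ofCurve (k ℓ rh : ℝ) (z : ℝ → HorizonData ι × SingularData ι) :
    Fields ι where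
  m := fun r => r / 2 * (k - (r - rh) * (z (r - rh)).2.2.1 + r ^ 2 / ℓ ^ 2)
  S := fun r => (z (r - rh)).1.1
  ω := fun i r => (z (r - rh)).1.2.1 i
  E := fun i r => (r - rh) * (z (r - rh)).2.1 i

lemma Fields.mu_ofCurve (k ℓ rh : ℝ) (z : ℝ → HorizonData ι × SingularData ι) {r : ℝ}
    (hr : r ≠ 0) : (Fields.ofCurve k ℓ rh z).mu k ℓ r = (r - rh) * (z (r - rh)).2.2.1 := by
  simp only [Fields.mu, Fields.ofCurve]
  field_simp
  ring

/-- The domain on which the system is regular apart from the Fuchsian singularity. -/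
def regularDomain (ι : Type*) (rh : ℝ) : Set (ℝ × HorizonData ι × SingularData ι) :=
  {v | rh + v.1 ≠ 0 ∧ v.2.1.1 ≠ 0 ∧ v.2.2.2.1 ≠ 0}

lemma isOpen_regularDomain (rh : ℝ) : IsOpen (regularDomain ι rh) :=
  (isOpen_ne_fun (by fun_prop) continuous_const).inter
    ((isOpen_ne_fun (by fun_prop) continuous_const).inter
      (isOpen_ne_fun (by fun_prop) continuous_const))

variable [Fintype ι] [DecidableEq ι]

/-- The right hand side of the field equations as a Fuchsian system in `ρ = r - r_h`, with the
regular unknowns `x = (S, ω_i, Q_i)`, `Q_i = r² ℰ_i'/S`, and the singular unknowns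
`y = (e_i, n, W_i) = (ℰ_i/ρ, μ/ρ, μ S ω_i'/ρ)`: the equations are `x' = F₁(ρ, x, y)` and
`(ρ y)' = F₂(ρ, x, y)`. -/
noncomputable def Couplings.horizonRHS (c : Couplings ι) (k ℓ rh : ℝ)
    (v : ℝ × HorizonData ι × SingularData ι) : HorizonData ι × SingularData ι :=
  ((v.2.1.1 * (2 / (rh + v.1)) * (c.G (fun i => v.2.2.2.2 i / (v.2.2.2.1 * v.2.1.1))
        + c.zeta v.2.1.2.1 v.2.2.1 / (v.2.2.2.1 ^ 2 * v.2.1.1 ^ 2)),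
    (fun i => v.2.2.2.2 i / (v.2.2.2.1 * v.2.1.1)),
    fun i => c.Z v.2.1.2.1 v.2.2.1 i / (v.2.2.2.1 * v.2.1.1)),
   ((fun i => v.2.1.1 * v.2.1.2.2 i / (rh + v.1) ^ 2),
    (k - v.1 * v.2.2.2.1) / (rh + v.1) + 3 * (rh + v.1) / ℓ ^ 2
      - 2 * (rh + v.1) * c.eta (fun i => v.2.1.1 * v.2.1.2.2 i / (rh + v.1) ^ 2) / v.2.1.1 ^ 2
      - 2 * v.1 * c.zeta v.2.1.2.1 v.2.2.1 / ((rh + v.1) * v.2.2.2.1 * v.2.1.1 ^ 2)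
      - 2 * v.1 * v.2.2.2.1 * c.G (fun i => v.2.2.2.2 i / (v.2.2.2.1 * v.2.1.1)) / (rh + v.1)
      - 2 * c.P k v.2.1.2.1 / (rh + v.1) ^ 3,
    fun i => -v.2.1.1 * (v.1 * v.2.2.1 i ^ 2 * v.2.1.2.1 i / (v.2.2.2.1 * v.2.1.1 ^ 2)
      + c.F k v.2.1.2.1 i / (rh + v.1) ^ 2)))

/-- The values of the singular unknowns at the horizon, determined by the regular ones. -/
noncomputable def Couplings.singularInit (c : Couplings ι) (k ℓ rh : ℝ) (x : HorizonData ι) :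
    SingularData ι :=
  ((fun i => x.1 * x.2.2 i / rh ^ 2),
    k / rh + 3 * rh / ℓ ^ 2 - 2 * rh * c.eta (fun i => x.1 * x.2.2 i / rh ^ 2) / x.1 ^ 2
      - 2 * c.P k x.2.1 / rh ^ 3,
    fun i => -x.1 * (c.F k x.2.1 i / rh ^ 2))

lemma Couplings.horizonRHS_zero (c : Couplings ι) (k ℓ rh : ℝ) (x : HorizonData ι)
    (y : SingularData ι) : (c.horizonRHS k ℓ rh (0, x, y)).2 = c.singularInit k ℓ rh x := by
  simp [Couplings.horizonRHS, Couplings.singularInit]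

lemma Couplings.singularInit_regularInit (c : Couplings ι) (k ℓ : ℝ) {rh : ℝ} (hrh : rh ≠ 0)
    {p : HorizonData ι} (hp : p.1 ≠ 0) :
    c.singularInit k ℓ rh (regularInit rh p)
      = (p.2.2, muPrime c k ℓ rh p, fun i => -p.1 * (c.F k p.2.1 i / rh ^ 2)) := by
  have h : (fun i => p.1 * (rh ^ 2 * p.2.2 i / p.1) / rh ^ 2) = p.2.2 := by
    ext i
    field_simp
  simp only [Couplings.singularInit, regularInit, h, muPrime]
  congr 2
  ring

lemma Couplings.analyticAt_horizonRHS (c : Couplings ι) (k ℓ : ℝ) {rh : ℝ}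
    {v : ℝ × HorizonData ι × SingularData ι} (hv : v ∈ regularDomain ι rh) :
    AnalyticAt ℝ (c.horizonRHS k ℓ rh) v := by
  obtain ⟨hr, hS, hn⟩ := hv
  have dr : ContDiffAt ℝ ⊤
      (fun v : ℝ × HorizonData ι × SingularData ι => rh + v.1) v := by fun_prop
  have dS : ContDiffAt ℝ ⊤
      (fun v : ℝ × HorizonData ι × SingularData ι => v.2.1.1) v := by fun_prop
  have dn : ContDiffAt ℝ ⊤
      (fun v : ℝ × HorizonData ι × SingularData ι => v.2.2.2.1) v := by fun_prop
  have dV : ContDiffAt ℝ ⊤ (fun v : ℝ × HorizonData ι × SingularData ι =>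
      fun i => v.2.2.2.2 i / (v.2.2.2.1 * v.2.1.1)) v :=
    contDiffAt_pi.2 fun i => ContDiffAt.div (by fun_prop) (dn.mul dS) (mul_ne_zero hn hS)
  have dD : ContDiffAt ℝ ⊤ (fun v : ℝ × HorizonData ι × SingularData ι =>
      fun i => v.2.1.1 * v.2.1.2.2 i / (rh + v.1) ^ 2) v :=
    contDiffAt_pi.2 fun i => ContDiffAt.div (by fun_prop) (dr.pow 2) (pow_ne_zero 2 hr)
  have dG := c.contDiff_G.contDiffAt.comp v dV
  have deta := c.contDiff_eta.contDiffAt.comp v dD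
  have dzeta : ContDiffAt ℝ ⊤ (fun v : ℝ × HorizonData ι × SingularData ι =>
      c.zeta v.2.1.2.1 v.2.2.1) v :=
    c.contDiff_zeta.contDiffAt.comp v
      (f := fun v : ℝ × HorizonData ι × SingularData ι => (v.2.1.2.1, v.2.2.1)) (by fun_prop)
  have dZ : ContDiffAt ℝ ⊤ (fun v : ℝ × HorizonData ι × SingularData ι =>
      c.Z v.2.1.2.1 v.2.2.1) v :=
    c.contDiff_Z.contDiffAt.comp v
      (f := fun v : ℝ × HorizonData ι × SingularData ι => (v.2.1.2.1, v.2.2.1)) (by fun_prop)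
  have dP : ContDiffAt ℝ ⊤ (fun v : ℝ × HorizonData ι × SingularData ι =>
      c.P k v.2.1.2.1) v :=
    (c.contDiff_P k).contDiffAt.comp v
      (f := fun v : ℝ × HorizonData ι × SingularData ι => v.2.1.2.1) (by fun_prop)
  have dF : ContDiffAt ℝ ⊤ (fun v : ℝ × HorizonData ι × SingularData ι =>
      c.F k v.2.1.2.1) v :=
    (c.contDiff_F k).contDiffAt.comp v
      (f := fun v : ℝ × HorizonData ι × SingularData ι => v.2.1.2.1) (by fun_prop)
  have h : ContDiffAt ℝ ⊤ (c.horizonRHS k ℓ rh) v := by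
    refine ContDiffAt.prodMk (ContDiffAt.prodMk ?_ (ContDiffAt.prodMk dV ?_))
      (ContDiffAt.prodMk dD (ContDiffAt.prodMk ?_ ?_))
    · exact (dS.mul (contDiffAt_const.div dr hr)).mul (dG.add (dzeta.div ((dn.pow 2).mul (dS.pow 2))
        (mul_ne_zero (pow_ne_zero 2 hn) (pow_ne_zero 2 hS))))
    · exact contDiffAt_pi.2 fun i =>
        (contDiffAt_pi.1 dZ i).div (dn.mul dS) (mul_ne_zero hn hS)
    · refine (((((ContDiffAt.div (by fun_prop) dr hr).add (by fun_prop)).sub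
        (((contDiffAt_const.mul dr).mul deta).div (dS.pow 2) (pow_ne_zero 2 hS))).sub
        (ContDiffAt.div (ContDiffAt.mul (by fun_prop) dzeta) ((dr.mul dn).mul (dS.pow 2))
          (mul_ne_zero (mul_ne_zero hr hn) (pow_ne_zero 2 hS)))).sub
        (ContDiffAt.div (ContDiffAt.mul (by fun_prop) dG) dr hr)).sub
        (ContDiffAt.div (contDiffAt_const.mul dP) (dr.pow 3) (pow_ne_zero 3 hr))
    · exact contDiffAt_pi.2 fun i => dS.neg.mul ((ContDiffAt.div (by fun_prop) (dn.mul (dS.pow 2))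
        (mul_ne_zero hn (pow_ne_zero 2 hS))).add
        ((contDiffAt_pi.1 dF i).div (dr.pow 2) (pow_ne_zero 2 hr)))
  exact h.analyticAt

/-- A solution of the field equations solves the Fuchsian system. -/
lemma SolvesAt.hasDerivAt_curve {c : Couplings ι} {k ℓ rh : ℝ} (hℓ : ℓ ≠ 0) {f : Fields ι} {r : ℝ}
    (hr : r ≠ rh) (h : SolvesAt c k ℓ f r) :
    HasDerivAt (fun r => (f.curve k ℓ rh r).1)
      (c.horizonRHS k ℓ rh (r - rh, f.curve k ℓ rh r)).1 r ∧
    HasDerivAt (fun r => (r - rh) • (f.curve k ℓ rh r).2)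
      (c.horizonRHS k ℓ rh (r - rh, f.curve k ℓ rh r)).2 r := by
  have h1 := h.firstOrderAt hℓ
  obtain ⟨hr0, hμ, hS⟩ := h.ne_zero
  have hρ : r - rh ≠ 0 := sub_ne_zero.2 hr
  have hV : (fun i => f.mu k ℓ r * f.S r * deriv (f.ω i) r / (r - rh)
      / (f.mu k ℓ r / (r - rh) * f.S r)) = fun i => deriv (f.ω i) r := by
    ext i
    field_simp
  have hD : (fun i => f.S r * (r ^ 2 * deriv (f.E i) r / f.S r) / r ^ 2)
      = fun i => deriv (f.E i) r := by
    ext i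
    field_simp
  have hEe : (fun i => f.E i r) = fun i => (r - rh) * (f.E i r / (r - rh)) := by
    ext i
    field_simp
  have hζ : c.zeta (fun i => f.ω i r) (fun i => f.E i r)
      = (r - rh) ^ 2 * c.zeta (fun i => f.ω i r) (fun i => f.E i r / (r - rh)) := by
    rw [← c.zeta_smul, ← hEe]
  have hZ : ∀ i, c.Z (fun i => f.ω i r) (fun i => f.E i r) i
      = (r - rh) * c.Z (fun i => f.ω i r) (fun i => f.E i r / (r - rh)) i := by
    intro i
    rw [← c.Z_smul, ← hEe]
  have hev : ∀ᶠ x in 𝓝 r, x - rh ≠ 0 := by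
    filter_upwards [isOpen_ne.mem_nhds hr] with x hx using sub_ne_zero.2 hx
  constructor
  · refine HasDerivAt.prodMk ?_ (HasDerivAt.prodMk (hasDerivAt_pi.2 fun i => ?_)
      (hasDerivAt_pi.2 fun i => ?_))
    · refine h1.S.congr_deriv ?_
      simp only [Fields.curve, add_sub_cancel, hV, hζ]
      field_simp
    · refine (h1.ω i).1.hasDerivAt.congr_deriv ?_
      exact (congrFun hV i).symm
    · refine (h1.electric i).congr_deriv ?_
      simp only [Fields.curve, hZ]
      field_simp
  · refine HasDerivAt.prodMk (hasDerivAt_pi.2 fun i => ?_) (HasDerivAt.prodMk ?_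
      (hasDerivAt_pi.2 fun i => ?_))
    · refine HasDerivAt.congr_deriv (f' := deriv (f.E i) r) ?_ ?_
      · refine HasDerivAt.congr_of_eventuallyEq (h1.E i).1.hasDerivAt ?_
        filter_upwards [hev] with x hx
        simp only [Fields.curve, smul_eq_mul, Pi.smul_apply]
        field_simp
      · simp only [Fields.curve, add_sub_cancel]
        exact (congrFun hD i).symm
    · refine HasDerivAt.congr_deriv (HasDerivAt.congr_of_eventuallyEq h1.mu ?_) ?_
      · filter_upwards [hev] with x hx
        simp only [Fields.curve, smul_eq_mul]
        field_simp
      · simp only [Fields.curve, add_sub_cancel, hV, hD, hζ]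
        field_simp
    · refine HasDerivAt.congr_deriv (HasDerivAt.congr_of_eventuallyEq (h1.magnetic i) ?_) ?_
      · filter_upwards [hev] with x hx
        simp only [Fields.curve, smul_eq_mul, Pi.smul_apply]
        field_simp
      · simp only [Fields.curve, add_sub_cancel]
        field_simp

/-- A solution of the Fuchsian system solves the field equations. -/
lemma solvesAt_ofCurve {c : Couplings ι} {k ℓ rh : ℝ} (hℓ : ℓ ≠ 0)
    {z : ℝ → HorizonData ι × SingularData ι} {r : ℝ} (hr : r ≠ rh)
    (hreg : (r - rh, z (r - rh)) ∈ regularDomain ι rh)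
    (hz : ∀ᶠ ρ in 𝓝 (r - rh), HasDerivAt (fun ρ => (z ρ).1) (c.horizonRHS k ℓ rh (ρ, z ρ)).1 ρ ∧
      HasDerivAt (fun ρ => ρ • (z ρ).2) (c.horizonRHS k ℓ rh (ρ, z ρ)).2 ρ) :
    SolvesAt c k ℓ (Fields.ofCurve k ℓ rh z) r := by
  obtain ⟨hr0, hS, hn⟩ := hreg
  simp only [add_sub_cancel] at hr0 hS hn
  have hρ : r - rh ≠ 0 := sub_ne_zero.2 hr
  set f := Fields.ofCurve k ℓ rh z with hf
  have hz' : ∀ᶠ x in 𝓝 r,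
      HasDerivAt (fun x => (z (x - rh)).1) (c.horizonRHS k ℓ rh (x - rh, z (x - rh))).1 x ∧
      HasDerivAt (fun x => (x - rh) • (z (x - rh)).2)
        (c.horizonRHS k ℓ rh (x - rh, z (x - rh))).2 x := by
    have ht : Tendsto (fun x => x - rh) (𝓝 r) (𝓝 (r - rh)) :=
      Continuous.tendsto' (by fun_prop) _ _ rfl
    filter_upwards [ht.eventually hz] with x hx
    exact ⟨hx.1.comp_sub_const x rh, hx.2.comp_sub_const x rh⟩
  have hdω : ∀ᶠ x in 𝓝 r, ∀ i, HasDerivAt (f.ω i)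
      ((z (x - rh)).2.2.2 i / ((z (x - rh)).2.2.1 * (z (x - rh)).1.1)) x := by
    filter_upwards [hz'] with x hx i
    exact hasDerivAt_pi.1 hx.1.snd.fst i
  have hdE : ∀ᶠ x in 𝓝 r, ∀ i, HasDerivAt (f.E i)
      ((z (x - rh)).1.1 * (z (x - rh)).1.2.2 i / x ^ 2) x := by
    filter_upwards [hz'] with x hx i
    refine HasDerivAt.congr_deriv (hasDerivAt_pi.1 hx.2.fst i) ?_
    simp only [Couplings.horizonRHS, add_sub_cancel]
  have hμev : ∀ᶠ x in 𝓝 r, f.mu k ℓ x = (x - rh) * (z (x - rh)).2.2.1 := by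
    filter_upwards [isOpen_ne.mem_nhds hr0] with x hx using Fields.mu_ofCurve k ℓ rh z hx
  have hμ := hμev.self_of_nhds
  have hdω' : ∀ i, deriv (f.ω i)
      =ᶠ[𝓝 r] fun x => (z (x - rh)).2.2.2 i / ((z (x - rh)).2.2.1 * (z (x - rh)).1.1) := fun i => by
    filter_upwards [hdω] with x hx using (hx i).deriv
  have hdE' : ∀ i, deriv (f.E i)
      =ᶠ[𝓝 r] fun x => (z (x - rh)).1.1 * (z (x - rh)).1.2.2 i / x ^ 2 := fun i => by
    filter_upwards [hdE] with x hx using (hx i).deriv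
  have hz0 := hz'.self_of_nhds
  have dS : HasDerivAt f.S _ r := hz0.1.fst
  have dQ : ∀ i, HasDerivAt (fun x => (z (x - rh)).1.2.2 i) _ r := fun i =>
    hasDerivAt_pi.1 hz0.1.snd.snd i
  have dn : HasDerivAt (fun x => (x - rh) * (z (x - rh)).2.2.1) _ r := hz0.2.snd.fst
  have dW : ∀ i, HasDerivAt (fun x => (x - rh) * (z (x - rh)).2.2.2 i) _ r := fun i =>
    hasDerivAt_pi.1 hz0.2.snd.snd i
  have hρev : ∀ᶠ x in 𝓝 r, x - rh ≠ 0 := by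
    filter_upwards [isOpen_ne.mem_nhds hr] with x hx using sub_ne_zero.2 hx
  have hSev : ∀ᶠ x in 𝓝 r, (z (x - rh)).1.1 ≠ 0 := dS.continuousAt.eventually_ne hS
  have hnev : ∀ᶠ x in 𝓝 r, (x - rh) * (z (x - rh)).2.2.1 ≠ 0 :=
    dn.continuousAt.eventually_ne (mul_ne_zero hρ hn)
  have eV : (fun i => deriv (f.ω i) r)
      = fun i => (z (r - rh)).2.2.2 i / ((z (r - rh)).2.2.1 * (z (r - rh)).1.1) := by
    ext i; exact (hdω' i).self_of_nhds
  have eD : (fun i => deriv (f.E i) r)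
      = fun i => (z (r - rh)).1.1 * (z (r - rh)).1.2.2 i / r ^ 2 := by
    ext i; exact (hdE' i).self_of_nhds
  have eζ : c.zeta (fun i => f.ω i r) (fun i => f.E i r)
      = (r - rh) ^ 2 * c.zeta (z (r - rh)).1.2.1 (z (r - rh)).2.1 :=
    c.zeta_smul (z (r - rh)).1.2.1 (z (r - rh)).2.1 (r - rh)
  have eZ : ∀ i, c.Z (fun i => f.ω i r) (fun i => f.E i r) i
      = (r - rh) * c.Z (z (r - rh)).1.2.1 (z (r - rh)).2.1 i :=
    c.Z_smul (z (r - rh)).1.2.1 (z (r - rh)).2.1 (r - rh)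
  have eS : f.S r = (z (r - rh)).1.1 := rfl
  have eω : (fun i => f.ω i r) = (z (r - rh)).1.2.1 := rfl
  refine FirstOrderAt.solvesAt hℓ ⟨⟨hr0, hμ ▸ mul_ne_zero hρ hn, hS⟩, ?_, ?_, fun i => ⟨?_, ?_⟩,
    fun i => ⟨?_, ?_⟩, fun i => ?_, fun i => ?_⟩
  · refine HasDerivAt.congr_deriv (HasDerivAt.congr_of_eventuallyEq dn hμev) ?_
    rw [eV, eD, eζ, hμ, eS, eω]
    simp only [Couplings.horizonRHS, add_sub_cancel]
    field_simp
  · refine dS.congr_deriv ?_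
    rw [eV, eζ, hμ, eS]
    simp only [Couplings.horizonRHS, add_sub_cancel]
    field_simp
  · exact (hdω.self_of_nhds i).differentiableAt
  · refine DifferentiableAt.congr_of_eventuallyEq (f := fun x =>
      ((x - rh) * (z (x - rh)).2.2.2 i) / (((x - rh) * (z (x - rh)).2.2.1) * f.S x)) ?_ ?_
    · exact (dW i).differentiableAt.div (dn.differentiableAt.mul dS.differentiableAt)
        (mul_ne_zero (mul_ne_zero hρ hn) hS)
    · filter_upwards [hdω' i, hρev] with x h1 h2
      rw [h1, mul_assoc, mul_div_mul_left _ _ h2]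
      rfl
  · exact (hdE.self_of_nhds i).differentiableAt
  · refine DifferentiableAt.congr_of_eventuallyEq (f := fun x =>
      f.S x * (z (x - rh)).1.2.2 i / x ^ 2) ?_ (hdE' i)
    exact (dS.differentiableAt.mul (dQ i).differentiableAt).div (by fun_prop) (pow_ne_zero 2 hr0)
  · refine HasDerivAt.congr_deriv (HasDerivAt.congr_of_eventuallyEq (dQ i) ?_) ?_
    · filter_upwards [hdE' i, hSev, isOpen_ne.mem_nhds hr0] with x h1 h2 h3
      have h4 : f.S x = (z (x - rh)).1.1 := rfl
      rw [h1, h4]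
      have h5 : x ≠ 0 := h3
      field_simp
    · rw [eZ, hμ, eS]
      simp only [Couplings.horizonRHS]
      field_simp
  · refine HasDerivAt.congr_deriv (HasDerivAt.congr_of_eventuallyEq (dW i) ?_) ?_
    · filter_upwards [hdω' i, hSev, hnev, hμev] with x h1 h2 h3 h4
      have h5 : f.S x = (z (x - rh)).1.1 := rfl
      rw [h1, h4, h5]
      have h6 : (z (x - rh)).2.2.1 ≠ 0 := right_ne_zero_of_mul h3
      field_simp
    · rw [hμ, eS, eω]
      have h1 : f.E i r = (r - rh) * (z (r - rh)).2.1 i := rfl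
      have h2 : f.ω i r = (z (r - rh)).1.2.1 i := rfl
      rw [h1, h2]
      simp only [Couplings.horizonRHS, add_sub_cancel]
      field_simp

end HorizonSystem

/-! ### Regularity at the horizon -/

section Slope

/-- If the derivative of a function on a convex set converges at a boundary point, so does the
function, and its difference quotients converge to the same limit as the derivative. -/
lemma exists_tendsto_slope {s : Set ℝ} {a : ℝ} (hs : Convex ℝ s) (ha : a ∉ s) [NeBot (𝓝[s] a)]
    {f f' : ℝ → ℝ} (hf : ∀ r ∈ s, HasDerivAt f (f' r) r) {L : ℝ}
    (hL : Tendsto f' (𝓝[s] a) (𝓝 L)) :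
    ∃ l, Tendsto f (𝓝[s] a) (𝓝 l) ∧
      Tendsto (fun r => (f r - l) / (r - a)) (𝓝[s] a) (𝓝 L) := by
  set h : ℝ → ℝ := fun r => f r - L * (r - a) with hh
  have hd : ∀ r ∈ s, HasDerivAt h (f' r - L) r := by
    intro r hr
    refine ((hf r hr).sub (((hasDerivAt_id r).sub_const a).const_mul L)).congr_deriv ?_
    simp
  have hlip : ∀ ε > 0, ∃ η > 0, ∀ x ∈ s ∩ Metric.ball a η, ∀ y ∈ s ∩ Metric.ball a η,
      |h y - h x| ≤ ε * |y - x| := by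
    intro ε hε
    have h1 : ∀ᶠ r in 𝓝[s] a, |f' r - L| < ε := by
      simpa [Real.dist_eq] using Metric.tendsto_nhds.1 hL ε hε
    obtain ⟨η, hη, h2⟩ := Metric.mem_nhdsWithin_iff.1 h1
    refine ⟨η, hη, fun x hx y hy => ?_⟩
    have := (hs.inter (convex_ball a η)).norm_image_sub_le_of_norm_hasDerivWithin_le
      (f := h) (f' := fun r => f' r - L) (C := ε)
      (fun r hr => (hd r hr.1).hasDerivWithinAt) (fun r hr => (h2 ⟨hr.2, hr.1⟩).le) hx hy
    simpa [Real.norm_eq_abs] using this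
  obtain ⟨l, hl⟩ : ∃ l, Tendsto h (𝓝[s] a) (𝓝 l) := by
    obtain ⟨η, hη, h1⟩ := hlip 1 one_pos
    have huc : UniformContinuousOn h (s ∩ Metric.ball a η) := by
      refine (LipschitzOnWith.of_dist_le_mul (K := 1) fun x hx y hy => ?_).uniformContinuousOn
      simpa [Real.dist_eq] using h1 y hy x hx
    have hle : 𝓝[s] a ≤ 𝓟 (s ∩ Metric.ball a η) :=
      le_principal_iff.2 (inter_mem self_mem_nhdsWithin
        (mem_nhdsWithin_of_mem_nhds (Metric.ball_mem_nhds a hη)))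
    exact CompleteSpace.complete
      ((cauchy_nhds.mono' ‹_› nhdsWithin_le_nhds).map_of_le huc hle)
  have hlin : Tendsto (fun r => L * (r - a)) (𝓝[s] a) (𝓝 0) :=
    tendsto_nhdsWithin_of_tendsto_nhds (Continuous.tendsto' (by fun_prop) _ _ (by simp))
  refine ⟨l, ?_, ?_⟩
  · have := hl.add hlin
    simpa [hh] using this
  · rw [Metric.tendsto_nhds]
    intro ε hε
    obtain ⟨η, hη, h1⟩ := hlip (ε / 2) (half_pos hε)
    have hmem : s ∩ Metric.ball a η ∈ 𝓝[s] a :=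
      inter_mem self_mem_nhdsWithin (mem_nhdsWithin_of_mem_nhds (Metric.ball_mem_nhds a hη))
    filter_upwards [hmem] with r hr
    have hra : r - a ≠ 0 := sub_ne_zero.2 fun e => ha (e ▸ hr.1)
    have h2 : |h r - l| ≤ ε / 2 * |r - a| := by
      have t1 : Tendsto (fun x => |h r - h x|) (𝓝[s] a) (𝓝 |h r - l|) :=
        (tendsto_const_nhds.sub hl).abs
      have t2 : Tendsto (fun x => ε / 2 * |r - x|) (𝓝[s] a) (𝓝 (ε / 2 * |r - a|)) :=
        tendsto_nhdsWithin_of_tendsto_nhds (Continuous.tendsto' (by fun_prop) _ _ rfl)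
      refine le_of_tendsto_of_tendsto t1 t2 ?_
      filter_upwards [hmem] with x hx using h1 x hx r hr
    rw [Real.dist_eq]
    have e : (f r - l) / (r - a) - L = (h r - l) / (r - a) := by
      simp only [hh]
      field_simp
      ring
    rw [e, abs_div, div_lt_iff₀ (abs_pos.2 hra)]
    have := abs_pos.2 hra
    nlinarith

/-- A form of l'Hôpital's rule: the limit of the difference quotients, once it exists, is that of
the derivative. -/
lemma tendsto_slope_of_tendsto_deriv {s : Set ℝ} {a : ℝ} (hs : Convex ℝ s) (ha : a ∉ s)
    [NeBot (𝓝[s] a)] {f f' : ℝ → ℝ} (hf : ∀ r ∈ s, HasDerivAt f (f' r) r) {L l : ℝ}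
    (hL : Tendsto f' (𝓝[s] a) (𝓝 L)) (hl : Tendsto f (𝓝[s] a) (𝓝 l)) :
    Tendsto (fun r => (f r - l) / (r - a)) (𝓝[s] a) (𝓝 L) := by
  obtain ⟨l', h1, h2⟩ := exists_tendsto_slope hs ha hf hL
  rwa [tendsto_nhds_unique hl h1]

end Slope

section Sides

variable {rh : ℝ} {s : Set ℝ}

lemma IsHorizonSide.convex (h : IsHorizonSide rh s) : Convex ℝ s := by
  obtain ⟨δ, hδ, rfl | rfl⟩ := h <;> exact convex_Ioo _ _

lemma IsHorizonSide.notMem (h : IsHorizonSide rh s) : rh ∉ s := by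
  obtain ⟨δ, hδ, rfl | rfl⟩ := h <;> simp

lemma IsHorizonSide.neBot (h : IsHorizonSide rh s) : NeBot (𝓝[s] rh) := by
  rw [← mem_closure_iff_nhdsWithin_neBot]
  obtain ⟨δ, hδ, rfl | rfl⟩ := h
  · rw [closure_Ioo (by linarith)]
    exact ⟨le_rfl, by linarith⟩
  · rw [closure_Ioo (by linarith)]
    exact ⟨by linarith, le_rfl⟩

end Sides

section Regularity

variable {ι : Type*}

lemma tendsto_of_isBigO_sub {l : Filter ℝ} {rh : ℝ} (hl : Tendsto (fun r => r - rh) l (𝓝 0))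
    {f : ℝ → ℝ} {a : ℝ} (h : (fun r => f r - a) =O[l] fun r => r - rh) : Tendsto f l (𝓝 a) := by
  simpa using (h.trans_tendsto hl).add_const a

lemma tendsto_div_of_isBigO_sq {l : Filter ℝ} {rh : ℝ} (hl : Tendsto (fun r => r - rh) l (𝓝 0))
    (hne : ∀ᶠ r in l, r ≠ rh) {f : ℝ → ℝ} {a : ℝ}
    (h : (fun r => f r - a * (r - rh)) =O[l] fun r => (r - rh) ^ 2) :
    Tendsto (fun r => f r / (r - rh)) l (𝓝 a) := by
  refine tendsto_of_isBigO_sub hl ?_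
  have h1 := h.mul (isBigO_refl (fun r => (r - rh)⁻¹) l)
  refine (h1.congr' ?_ ?_)
  · filter_upwards [hne] with r hr
    have := sub_ne_zero.2 hr
    field_simp
  · filter_upwards [hne] with r hr
    have := sub_ne_zero.2 hr
    field_simp

variable [Fintype ι] [DecidableEq ι]

/-- A solution with the expansions at the horizon is regular there: the unknowns of the Fuchsian
system converge to the initial values determined by `p`, and the slope of `μ` is `μ'_h(p)`. -/
theorem HorizonExpansion.tendsto_curve {c : Couplings ι} {k ℓ rh : ℝ} (hℓ : ℓ ≠ 0) (hrh : rh ≠ 0)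
    {s : Set ℝ} (hs : IsHorizonSide rh s) {p : HorizonData ι} (hp : p.1 ≠ 0) {ν : ℝ} (hν : ν ≠ 0)
    {g : Fields ι} (hg : ∀ r ∈ s, SolvesAt c k ℓ g r)
    (hexp : HorizonExpansion k ℓ rh g p ν (𝓝[s] rh)) :
    ν = muPrime c k ℓ rh p ∧
    Tendsto (g.curve k ℓ rh) (𝓝[s] rh)
      (𝓝 (regularInit rh p, c.singularInit k ℓ rh (regularInit rh p))) := by
  have hcv := hs.convex
  have hns := hs.notMem
  have := hs.neBot
  have hmem : ∀ᶠ r in 𝓝[s] rh, r ∈ s := self_mem_nhdsWithin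
  have hne : ∀ᶠ r in 𝓝[s] rh, r ≠ rh := hmem.mono fun r hr e => hns (e ▸ hr)
  have tr : Tendsto (fun r => r) (𝓝[s] rh) (𝓝 rh) :=
    tendsto_nhdsWithin_of_tendsto_nhds tendsto_id
  have tρ : Tendsto (fun r => r - rh) (𝓝[s] rh) (𝓝 0) := by simpa using tr.sub_const rh
  have tS : Tendsto g.S (𝓝[s] rh) (𝓝 p.1) := tendsto_of_isBigO_sub tρ hexp.S
  have tω : ∀ i, Tendsto (g.ω i) (𝓝[s] rh) (𝓝 (p.2.1 i)) := fun i =>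
    tendsto_of_isBigO_sub tρ (hexp.ω i)
  have te : ∀ i, Tendsto (fun r => g.E i r / (r - rh)) (𝓝[s] rh) (𝓝 (p.2.2 i)) := fun i =>
    tendsto_div_of_isBigO_sq tρ hne (hexp.E i)
  have tn : Tendsto (fun r => g.mu k ℓ r / (r - rh)) (𝓝[s] rh) (𝓝 ν) :=
    tendsto_div_of_isBigO_sq tρ hne hexp.mu
  have hzero : ∀ {f : ℝ → ℝ} {a : ℝ}, Tendsto (fun r => f r / (r - rh)) (𝓝[s] rh) (𝓝 a) →
      Tendsto f (𝓝[s] rh) (𝓝 0) := by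
    intro f a hf
    have h1 := hf.mul tρ
    rw [mul_zero] at h1
    refine h1.congr' ?_
    filter_upwards [hne] with r hr
    have := sub_ne_zero.2 hr
    field_simp
  have tωv : Tendsto (fun r i => g.ω i r) (𝓝[s] rh) (𝓝 p.2.1) := tendsto_pi_nhds.2 tω
  have tev : Tendsto (fun r i => g.E i r / (r - rh)) (𝓝[s] rh) (𝓝 p.2.2) := tendsto_pi_nhds.2 te
  have hd : ∀ r ∈ s, _ := fun r hr =>
    (hg r hr).hasDerivAt_curve (rh := rh) hℓ (fun e => hns (e ▸ hr))
  -- the electric fields: `r² ℰ'/S` has a convergent derivative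
  have tQ : ∀ i, Tendsto (fun r => r ^ 2 * deriv (g.E i) r / g.S r) (𝓝[s] rh)
      (𝓝 (rh ^ 2 * p.2.2 i / p.1)) := by
    intro i
    have h1 : ∀ r ∈ s, HasDerivAt (fun r => r ^ 2 * deriv (g.E i) r / g.S r) _ r :=
      fun r hr => hasDerivAt_pi.1 (hd r hr).1.snd.snd i
    have h2 : Tendsto (fun r => c.Z (fun i => g.ω i r) (fun i => g.E i r / (r - rh)) i
        / (g.mu k ℓ r / (r - rh) * g.S r)) (𝓝[s] rh) (𝓝 (c.Z p.2.1 p.2.2 i / (ν * p.1))) := by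
      refine Tendsto.div ?_ (tn.mul tS) (mul_ne_zero hν hp)
      have h3 := (c.contDiff_Z.continuous.tendsto (p.2.1, p.2.2)).comp (tωv.prodMk_nhds tev)
      exact tendsto_pi_nhds.1 h3 i
    obtain ⟨q, h3, -⟩ := exists_tendsto_slope hcv hns h1 h2
    have h4 : Tendsto (deriv (g.E i)) (𝓝[s] rh) (𝓝 (q * p.1 / rh ^ 2)) := by
      refine ((h3.mul tS).div (tr.pow 2) (pow_ne_zero 2 hrh)).congr' ?_
      filter_upwards [hmem] with r hr
      obtain ⟨h5, -, h6⟩ := (hg r hr).ne_zero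
      simp only [Pi.div_apply]
      field_simp
    have h5 := tendsto_slope_of_tendsto_deriv hcv hns
      (fun r hr => ((hg r hr).diff_E i).1.hasDerivAt) h4 (hzero (te i))
    simp only [sub_zero] at h5
    have h6 := tendsto_nhds_unique h5 (te i)
    rw [← h6]
    convert h3 using 2
    field_simp
  -- the magnetic fields: `μ S ω'` converges, and a nonzero limit would make `ω` logarithmic
  have tW : ∀ i, Tendsto (fun r => g.mu k ℓ r * g.S r * deriv (g.ω i) r / (r - rh)) (𝓝[s] rh)
      (𝓝 (-p.1 * (c.F k p.2.1 i / rh ^ 2))) := by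
    intro i
    have h1 : ∀ r ∈ s, HasDerivAt
        (fun r => (r - rh) * (g.mu k ℓ r * g.S r * deriv (g.ω i) r / (r - rh))) _ r :=
      fun r hr => hasDerivAt_pi.1 (hd r hr).2.snd.snd i
    have h2 : Tendsto (fun r => -g.S r * ((r - rh) * (g.E i r / (r - rh)) ^ 2 * g.ω i r
        / (g.mu k ℓ r / (r - rh) * g.S r ^ 2) + c.F k (fun j => g.ω j r) i / (rh + (r - rh)) ^ 2))
        (𝓝[s] rh) (𝓝 (-p.1 * (c.F k p.2.1 i / rh ^ 2))) := by
      have h3 : Tendsto (fun r => c.F k (fun j => g.ω j r) i) (𝓝[s] rh) (𝓝 (c.F k p.2.1 i)) :=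
        tendsto_pi_nhds.1 (((c.contDiff_F k).continuous.tendsto p.2.1).comp tωv) i
      have h4 := tS.neg.mul ((((tρ.mul ((te i).pow 2)).mul (tω i)).div (tn.mul (tS.pow 2))
        (mul_ne_zero hν (pow_ne_zero 2 hp))).add (h3.div ((tρ.const_add rh).pow 2)
          (by simpa using hrh)))
      simpa using h4
    obtain ⟨a, h3, h4⟩ := exists_tendsto_slope hcv hns h1 h2
    have h5 : ∀ r ∈ s, HasDerivAt (fun r => (r - rh) * (g.ω i r - p.2.1 i))
        ((g.ω i r - p.2.1 i) + (r - rh) * deriv (g.ω i) r) r := by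
      intro r hr
      refine (((hasDerivAt_id r).sub_const rh).mul
        (((hg r hr).diff_ω i).1.hasDerivAt.sub_const (p.2.1 i))).congr_deriv ?_
      simp
    have h6 : Tendsto (fun r => (g.ω i r - p.2.1 i) + (r - rh) * deriv (g.ω i) r) (𝓝[s] rh)
        (𝓝 (0 + a / (ν * p.1))) := by
      refine Tendsto.add (by simpa using (tω i).sub_const (p.2.1 i)) ?_
      refine (h3.div (tn.mul tS) (mul_ne_zero hν hp)).congr' ?_
      filter_upwards [hmem, hne] with r hr hr'
      obtain ⟨-, h7, h8⟩ := (hg r hr).ne_zero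
      have := sub_ne_zero.2 hr'
      simp only [Pi.div_apply]
      field_simp
    have h7 : Tendsto (fun r => g.ω i r - p.2.1 i) (𝓝[s] rh) (𝓝 0) := by
      simpa using (tω i).sub_const (p.2.1 i)
    have h8 := tendsto_slope_of_tendsto_deriv hcv hns h5 h6
      (by simpa using tρ.mul h7)
    have h9 : Tendsto (fun r => g.ω i r - p.2.1 i) (𝓝[s] rh) (𝓝 (0 + a / (ν * p.1))) := by
      refine h8.congr' ?_
      filter_upwards [hne] with r hr
      have := sub_ne_zero.2 hr
      field_simp
      ring
    have ha : a = 0 := by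
      have := tendsto_nhds_unique h9 h7
      simpa [hν, hp] using this
    rw [ha] at h4
    refine h4.congr' ?_
    filter_upwards [hne] with r hr
    have := sub_ne_zero.2 hr
    field_simp
    ring
  -- the metric: the derivative of `μ` converges to `μ'_h(p)`
  have hμ : Tendsto (fun r => g.mu k ℓ r / (r - rh)) (𝓝[s] rh) (𝓝 (muPrime c k ℓ rh p)) := by
    have h1 : ∀ r ∈ s, HasDerivAt (fun r => (r - rh) * (g.mu k ℓ r / (r - rh))) _ r :=
      fun r hr => (hd r hr).2.snd.fst
    have tz : Tendsto (fun r => (r - rh, g.curve k ℓ rh r)) (𝓝[s] rh)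
        (𝓝 (0, regularInit rh p, p.2.2, ν, fun i => -p.1 * (c.F k p.2.1 i / rh ^ 2))) :=
      tρ.prodMk_nhds ((tS.prodMk_nhds (tωv.prodMk_nhds (tendsto_pi_nhds.2 tQ))).prodMk_nhds
        (tev.prodMk_nhds (tn.prodMk_nhds (tendsto_pi_nhds.2 tW))))
    have hreg : (0, regularInit rh p, p.2.2, ν, fun i => -p.1 * (c.F k p.2.1 i / rh ^ 2))
        ∈ regularDomain ι rh := ⟨by simpa using hrh, hp, hν⟩
    have h2 := (c.analyticAt_horizonRHS k ℓ hreg).continuousAt.tendsto.comp tz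
    have h3 := (continuous_fst.comp (continuous_snd.comp continuous_snd)).continuousAt.tendsto.comp
      h2
    simp only [Function.comp_def, c.horizonRHS_zero, c.singularInit_regularInit k ℓ hrh hp] at h3
    have h4 := tendsto_slope_of_tendsto_deriv hcv hns h1 h3 (l := 0) (by simpa using tρ.mul tn)
    refine h4.congr' ?_
    filter_upwards [hne] with r hr
    have := sub_ne_zero.2 hr
    field_simp
    ring
  refine ⟨tendsto_nhds_unique tn hμ, ?_⟩
  rw [c.singularInit_regularInit k ℓ hrh hp]
  exact (tS.prodMk_nhds (tωv.prodMk_nhds (tendsto_pi_nhds.2 tQ))).prodMk_nhds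
    (tev.prodMk_nhds (hμ.prodMk_nhds (tendsto_pi_nhds.2 tW)))

end Regularity

/-! ### Solutions at a regular non-extremal horizon -/

section Horizon

variable {ι : Type*}

lemma analyticAt_regularInit [Fintype ι] (rh : ℝ) {p : HorizonData ι} (hp : p.1 ≠ 0) :
    AnalyticAt ℝ (regularInit rh) p := by
  have h : ContDiffAt ℝ ⊤ (regularInit (ι := ι) rh) p := by
    refine contDiffAt_fst.prodMk (ContDiffAt.prodMk (by fun_prop) (contDiffAt_pi.2 fun i => ?_))
    exact ContDiffAt.div (by fun_prop) contDiffAt_fst hp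
  exact h.analyticAt

variable [Fintype ι] [DecidableEq ι]

lemma isOpen_admissible (c : Couplings ι) (k ℓ rh : ℝ) : IsOpen (Admissible c k ℓ rh) := by
  rw [isOpen_iff_mem_nhds]
  rintro p ⟨hp, hμ⟩
  have h1 : ContinuousAt (muPrime c k ℓ rh) p := by
    have hP : Continuous fun p : HorizonData ι => c.P k p.2.1 :=
      (c.contDiff_P k).continuous.comp (by fun_prop)
    have hη : Continuous fun p : HorizonData ι => c.eta p.2.2 :=
      c.contDiff_eta.continuous.comp (by fun_prop)
    exact (continuousAt_const.sub ((continuousAt_const.mul hP.continuousAt).div_const _)).sub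
      ((continuousAt_const.mul hη.continuousAt).div (by fun_prop) (pow_ne_zero 2 hp))
  exact (continuousAt_fst.eventually_ne hp).and (h1.eventually_const_lt hμ)

/-- A solution with the expansions at the horizon, extended to `ρ = 0` by its limits, is a
continuous solution of the Fuchsian system on an interval containing `0`, to which the uniqueness
`hφ` for that system applies. -/
lemma curve_eq_of_unique {c : Couplings ι} {k ℓ rh ε : ℝ} (hℓ : ℓ ≠ 0) (hrh : rh ≠ 0) (hε : 0 < ε)
    {p : HorizonData ι} (hp : p ∈ Admissible c k ℓ rh) {φ : ℝ → HorizonData ι × SingularData ι}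
    (hφ : ∀ J ⊆ Ioo (-ε) ε, J.OrdConnected → (0 : ℝ) ∈ J →
      ∀ z : ℝ → HorizonData ι × SingularData ι, ContinuousOn z J →
        z 0 = (regularInit rh p, c.singularInit k ℓ rh (regularInit rh p)) →
        ContinuousOn (fun ρ => c.horizonRHS k ℓ rh (ρ, z ρ)) J →
        (∀ ρ ∈ J, ρ ≠ 0 →
          HasDerivAt (fun ρ => (z ρ).1) (c.horizonRHS k ℓ rh (ρ, z ρ)).1 ρ ∧
          HasDerivAt (fun ρ => ρ • (z ρ).2) (c.horizonRHS k ℓ rh (ρ, z ρ)).2 ρ) →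
        ∀ ρ ∈ J, z ρ = φ ρ)
    {s : Set ℝ} (hs : IsHorizonSide rh s) {g : Fields ι} (hg : ∀ r ∈ s, SolvesAt c k ℓ g r)
    (hexp : HorizonExpansion k ℓ rh g p (muPrime c k ℓ rh p) (𝓝[s] rh)) {r : ℝ} (hr : r ∈ s)
    (hrε : r ∈ Ioo (rh - ε) (rh + ε)) : g.curve k ℓ rh r = φ (r - rh) := by
  obtain ⟨-, hlim⟩ := hexp.tendsto_curve hℓ hrh hs hp.1 hp.2.ne' hg
  set z₀ := (regularInit rh p, c.singularInit k ℓ rh (regularInit rh p)) with hz₀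
  set z : ℝ → HorizonData ι × SingularData ι := fun ρ =>
    if ρ = 0 then z₀ else g.curve k ℓ rh (rh + ρ) with hz
  set J : Set ℝ := {ρ | ρ ∈ Ioo (-ε) ε ∧ (ρ = 0 ∨ rh + ρ ∈ s)} with hJ
  have hJs : ∀ {ρ}, ρ ∈ J → ρ ≠ 0 → rh + ρ ∈ s := fun h h0 => h.2.resolve_left h0
  have hz0 : z 0 = z₀ := by simp [hz]
  have hzne : ∀ {ρ}, ρ ≠ 0 → z ρ = g.curve k ℓ rh (rh + ρ) := by
    intro ρ h; simp [hz, h]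
  have hzev : ∀ {ρ : ℝ}, ρ ≠ 0 → z =ᶠ[𝓝 ρ] fun ρ => g.curve k ℓ rh (rh + ρ) := by
    intro ρ h
    filter_upwards [isOpen_ne.mem_nhds h] with x hx using hzne hx
  have h0J : (0 : ℝ) ∈ J := ⟨by simp [hε], Or.inl rfl⟩
  have hJoc : J.OrdConnected := by
    refine ⟨fun x hx y hy t ht => ?_⟩
    refine ⟨⟨hx.1.1.trans_le ht.1, ht.2.trans_lt hy.1.2⟩, ?_⟩
    by_cases h0 : t = 0
    · exact Or.inl h0
    right
    have hx2 := hx.2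
    have hy2 := hy.2
    rcases lt_or_gt_of_ne h0 with h0 | h0
    · obtain ⟨δ, hδ, rfl | rfl⟩ := hs
      · have := ht.1
        rcases hx2 with h | h
        · linarith
        · have := h.1; linarith
      · rcases hx2 with h | h
        · have := ht.1; linarith
        · exact ⟨by linarith [h.1, ht.1], by linarith⟩
    · obtain ⟨δ, hδ, rfl | rfl⟩ := hs
      · rcases hy2 with h | h
        · have := ht.2; linarith
        · exact ⟨by linarith, by linarith [h.2, ht.2]⟩
      · have := ht.2
        rcases hy2 with h | h
        · linarith
        · have := h.2; linarith
  have hzd : ∀ ρ ∈ J, ρ ≠ 0 →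
      HasDerivAt (fun ρ => (z ρ).1) (c.horizonRHS k ℓ rh (ρ, z ρ)).1 ρ ∧
      HasDerivAt (fun ρ => ρ • (z ρ).2) (c.horizonRHS k ℓ rh (ρ, z ρ)).2 ρ := by
    intro ρ hρ h0
    have h1 := (hg _ (hJs hρ h0)).hasDerivAt_curve (rh := rh) hℓ (by simpa using h0)
    rw [add_sub_cancel_left, ← hzne h0] at h1
    constructor
    · refine HasDerivAt.congr_of_eventuallyEq (h1.1.comp_const_add rh ρ) ?_
      filter_upwards [hzev h0] with x hx
      rw [hx]
    · refine HasDerivAt.congr_of_eventuallyEq (h1.2.comp_const_add rh ρ) ?_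
      filter_upwards [hzev h0] with x hx
      rw [hx, add_sub_cancel_left]
  have hzc : ContinuousOn z J := by
    intro ρ hρ
    by_cases h0 : ρ = 0
    · subst h0
      rw [← continuousWithinAt_sdiff_self]
      have ht : Tendsto (fun ρ => rh + ρ) (𝓝[J \ {0}] 0) (𝓝[s] rh) := by
        refine tendsto_nhdsWithin_iff.2 ⟨tendsto_nhdsWithin_of_tendsto_nhds
          (Continuous.tendsto' (by fun_prop) _ _ (by simp)), ?_⟩
        filter_upwards [self_mem_nhdsWithin] with ρ hρ using hJs hρ.1 hρ.2
      refine Tendsto.congr' ?_ (hz0.symm ▸ hlim.comp ht)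
      filter_upwards [self_mem_nhdsWithin] with ρ hρ using (hzne hρ.2).symm
    · have h1 := hzd ρ hρ h0
      have h2 : ContinuousAt (fun x => ((z x).1, x⁻¹ • (x • (z x).2))) ρ :=
        h1.1.continuousAt.prodMk ((continuousAt_inv₀ h0).smul h1.2.continuousAt)
      refine (h2.congr ?_).continuousWithinAt
      filter_upwards [isOpen_ne.mem_nhds h0] with x hx
      rw [inv_smul_smul₀ hx]
  have hreg : ∀ ρ ∈ J, (ρ, z ρ) ∈ regularDomain ι rh := by
    intro ρ hρ
    by_cases h0 : ρ = 0
    · subst h0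
      rw [hz0, hz₀, c.singularInit_regularInit k ℓ hrh hp.1]
      exact ⟨by simpa using hrh, hp.1, hp.2.ne'⟩
    · obtain ⟨h1, h2, h3⟩ := (hg _ (hJs hρ h0)).ne_zero
      rw [hzne h0]
      exact ⟨h1, h3, div_ne_zero h2 (by simpa using h0)⟩
  have hFc : ContinuousOn (fun ρ => c.horizonRHS k ℓ rh (ρ, z ρ)) J := fun ρ hρ =>
    ContinuousAt.comp_continuousWithinAt (f := fun ρ => (ρ, z ρ))
      (c.analyticAt_horizonRHS k ℓ (hreg ρ hρ)).continuousAt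
      (continuousWithinAt_id.prodMk (hzc ρ hρ))
  have hr0 : r - rh ≠ 0 := sub_ne_zero.2 fun e => hs.notMem (e ▸ hr)
  have hrJ : r - rh ∈ J := ⟨⟨by linarith [hrε.1], by linarith [hrε.2]⟩, Or.inr (by simpa using hr)⟩
  have := hφ J (fun ρ hρ => hρ.1) hJoc h0J z hzc hz0 hFc hzd _ hrJ
  rw [← this, hzne hr0, add_sub_cancel]

/-- Existence, analyticity and uniqueness at a regular non-extremal horizon, for arbitrary constants
in the field equations. -/
theorem exists_analytic_horizon_solution (c : Couplings ι) {k ℓ rh : ℝ} (hℓ : ℓ ≠ 0) (hrh : rh ≠ 0)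
    {p₀ : HorizonData ι} (hp₀ : p₀ ∈ Admissible c k ℓ rh) :
    ∃ U : Set (HorizonData ι), IsOpen U ∧ p₀ ∈ U ∧ U ⊆ Admissible c k ℓ rh ∧
      ∃ ε : ℝ, 0 < ε ∧ ∃ f : HorizonData ι → Fields ι,
        (AnalyticOnNhd ℝ (fun q : HorizonData ι × ℝ => (f q.1).m q.2)
            (U ×ˢ Ioo (rh - ε) (rh + ε)) ∧
          AnalyticOnNhd ℝ (fun q : HorizonData ι × ℝ => (f q.1).S q.2)
            (U ×ˢ Ioo (rh - ε) (rh + ε)) ∧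
          (∀ j, AnalyticOnNhd ℝ (fun q : HorizonData ι × ℝ => (f q.1).ω j q.2)
            (U ×ˢ Ioo (rh - ε) (rh + ε))) ∧
          ∀ j, AnalyticOnNhd ℝ (fun q : HorizonData ι × ℝ => (f q.1).E j q.2)
            (U ×ˢ Ioo (rh - ε) (rh + ε))) ∧
        ∀ p ∈ U,
          (∀ r ∈ Ioo (rh - ε) (rh + ε), r ≠ rh → SolvesAt c k ℓ (f p) r) ∧
          HorizonExpansion k ℓ rh (f p) p (muPrime c k ℓ rh p) (𝓝 rh) ∧
          ∀ s : Set ℝ, IsHorizonSide rh s → ∀ g : Fields ι,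
            (∀ r ∈ s, SolvesAt c k ℓ g r) →
            HorizonExpansion k ℓ rh g p (muPrime c k ℓ rh p) (𝓝[s] rh) →
            ∀ r ∈ s ∩ Ioo (rh - ε) (rh + ε),
              g.m r = (f p).m r ∧ g.S r = (f p).S r ∧
              (∀ j, g.ω j r = (f p).ω j r) ∧ ∀ j, g.E j r = (f p).E j r := by
  have hreg : (0, regularInit rh p₀, c.singularInit k ℓ rh (regularInit rh p₀))
      ∈ regularDomain ι rh := by
    rw [c.singularInit_regularInit k ℓ hrh hp₀.1]
    exact ⟨by simpa using hrh, hp₀.1, hp₀.2.ne'⟩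
  obtain ⟨U₀, hU₀, hpU₀, ε, hε, φ, hφan, hφ⟩ := exists_analytic_fuchsian
    (c.analyticAt_horizonRHS k ℓ hreg) (c.horizonRHS_zero k ℓ rh)
    ((isOpen_regularDomain rh).mem_nhds hreg)
  have hnhds : {p | p ∈ Admissible c k ℓ rh ∧ regularInit rh p ∈ U₀} ∈ 𝓝 p₀ :=
    Filter.Eventually.and ((isOpen_admissible c k ℓ rh).mem_nhds hp₀)
      ((analyticAt_regularInit rh hp₀.1).continuousAt.preimage_mem_nhds (hU₀.mem_nhds hpU₀))
  obtain ⟨U, hUsub, hU, hpU⟩ := mem_nhds_iff.1 hnhds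
  have hρ : ∀ {r}, r ∈ Ioo (rh - ε) (rh + ε) → r - rh ∈ Ioo (-ε) ε := fun h =>
    ⟨by linarith [h.1], by linarith [h.2]⟩
  have han : ∀ q ∈ U ×ˢ Ioo (rh - ε) (rh + ε),
      AnalyticAt ℝ (fun q : HorizonData ι × ℝ => φ (regularInit rh q.1, q.2 - rh)) q := by
    intro q hq
    refine AnalyticAt.comp (g := φ)
      (f := fun q : HorizonData ι × ℝ => (regularInit rh q.1, q.2 - rh))
      (hφan _ ⟨(hUsub hq.1).2, hρ hq.2⟩) ?_
    exact ((analyticAt_regularInit rh (hUsub hq.1).1.1).fun_comp analyticAt_fst).prod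
      (analyticAt_snd.sub analyticAt_const)
  refine ⟨U, hU, hpU, fun p hp => (hUsub hp).1, ε, hε,
    fun p => Fields.ofCurve k ℓ rh fun ρ => φ (regularInit rh p, ρ), ⟨?_, ?_, ?_, ?_⟩, ?_⟩
  · intro q hq
    have h1 := (han q hq).contDiffAt (n := ⊤)
    have h2 : ContDiffAt ℝ ⊤ (fun q : HorizonData ι × ℝ =>
        (φ (regularInit rh q.1, q.2 - rh)).2.2.1) q := h1.snd.snd.fst
    have h3 : ContDiffAt ℝ ⊤ (fun q : HorizonData ι × ℝ => q.2 / 2 * (k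
        - (q.2 - rh) * (φ (regularInit rh q.1, q.2 - rh)).2.2.1 + q.2 ^ 2 / ℓ ^ 2)) q :=
      ContDiffAt.mul (by fun_prop)
        ((contDiffAt_const.sub (ContDiffAt.mul (by fun_prop) h2)).add (by fun_prop))
    exact h3.analyticAt
  · intro q hq
    have h1 := (han q hq).contDiffAt (n := ⊤)
    exact h1.fst.fst.analyticAt
  · intro j q hq
    have h1 := (han q hq).contDiffAt (n := ⊤)
    exact (contDiffAt_pi.1 h1.fst.snd.fst j).analyticAt
  · intro j q hq
    have h1 := (han q hq).contDiffAt (n := ⊤)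
    have h2 : ContDiffAt ℝ ⊤ (fun q : HorizonData ι × ℝ =>
        (q.2 - rh) * (φ (regularInit rh q.1, q.2 - rh)).2.1 j) q :=
      ContDiffAt.mul (by fun_prop) (contDiffAt_pi.1 h1.snd.fst j)
    exact h2.analyticAt
  intro p hp
  obtain ⟨hadm, hpU'⟩ := hUsub hp
  obtain ⟨hφ0, hφd, hφu⟩ := hφ _ hpU'
  rw [c.singularInit_regularInit k ℓ hrh hadm.1] at hφ0
  have hsolve : ∀ r ∈ Ioo (rh - ε) (rh + ε), r ≠ rh →
      SolvesAt c k ℓ (Fields.ofCurve k ℓ rh fun ρ => φ (regularInit rh p, ρ)) r := by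
    intro r hr hne
    refine solvesAt_ofCurve hℓ hne (hφd _ (hρ hr)).1 ?_
    filter_upwards [isOpen_Ioo.mem_nhds (hρ hr)] with ρ hρ using (hφd ρ hρ).2
  refine ⟨hsolve, ?_, ?_⟩
  · have hdiff : DifferentiableAt ℝ (fun r => φ (regularInit rh p, r - rh)) rh := by
      have h1 := (han (p, rh) ⟨hp, by simp [hε]⟩).differentiableAt
      exact h1.comp (f := fun r : ℝ => (p, r)) rh (by fun_prop)
    have hO : ∀ {u : ℝ → ℝ} {a : ℝ}, DifferentiableAt ℝ u rh → u rh = a →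
        (fun r => u r - a) =O[𝓝 rh] fun r => r - rh := fun hu ha => ha ▸ hu.isBigO_sub
    have hO2 : ∀ {u v : ℝ → ℝ} {a : ℝ}, DifferentiableAt ℝ u rh → u rh = a →
        (∀ᶠ r in 𝓝 rh, v r = (r - rh) * u r) →
        (fun r => v r - a * (r - rh)) =O[𝓝 rh] fun r => (r - rh) ^ 2 := by
      intro u v a hu ha hv
      refine ((isBigO_refl (fun r => r - rh) (𝓝 rh)).mul (hO hu ha)).congr' ?_ ?_
      · filter_upwards [hv] with r hr
        rw [hr]; ring
      · exact Eventually.of_forall fun r => (sq _).symm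
    refine ⟨?_, ?_, fun j => ?_, fun j => ?_⟩
    · refine hO2 (u := fun r => (φ (regularInit rh p, r - rh)).2.2.1) hdiff.snd.snd.fst
        (by simp [hφ0]) ?_
      filter_upwards [isOpen_ne.mem_nhds hrh] with r hr using Fields.mu_ofCurve k ℓ rh _ hr
    · exact hO (u := fun r => (φ (regularInit rh p, r - rh)).1.1) hdiff.fst.fst
        (by rw [sub_self, hφ0]; rfl)
    · exact hO (u := fun r => (φ (regularInit rh p, r - rh)).1.2.1 j)
        (differentiableAt_pi.1 hdiff.fst.snd.fst j) (by rw [sub_self, hφ0]; rfl)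
    · exact hO2 (u := fun r => (φ (regularInit rh p, r - rh)).2.1 j)
        (differentiableAt_pi.1 hdiff.snd.fst j) (by simp [hφ0]) (Eventually.of_forall fun r => rfl)
  · intro s hs g hg hexp r hr
    have hz := curve_eq_of_unique hℓ hrh hε hadm (φ := fun ρ => φ (regularInit rh p, ρ)) hφu hs hg
      hexp hr.1 hr.2
    have hne : r ≠ rh := fun e => hs.notMem (e ▸ hr.1)
    have hρ0 := sub_ne_zero.2 hne
    have hr0 := (hg r hr.1).ne_zero.1
    refine ⟨?_, congrArg (fun z => z.1.1) hz, fun j => congrArg (fun z => z.1.2.1 j) hz,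
      fun j => ?_⟩
    · have h1 : g.mu k ℓ r / (r - rh) = (φ (regularInit rh p, r - rh)).2.2.1 :=
        congrArg (fun z => z.2.2.1) hz
      rw [g.m_eq k ℓ hr0, Fields.m_eq _ k ℓ hr0, Fields.mu_ofCurve k ℓ rh _ hr0, ← h1,
        mul_div_cancel₀ _ hρ0]
    · have h1 : g.E j r / (r - rh) = (φ (regularInit rh p, r - rh)).2.1 j :=
        congrArg (fun z => z.2.1 j) hz
      change g.E j r = (r - rh) * (φ (regularInit rh p, r - rh)).2.1 j
      rw [← h1, mul_div_cancel₀ _ hρ0]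

end Horizon

end EYM

theorem mainTheorem6 {𝔤 : Type*} [LieRing 𝔤] [LieAlgebra ℂ 𝔤] [FiniteDimensional ℂ 𝔤]
    [LieAlgebra.IsSemisimple ℂ 𝔤] (H : LieSubalgebra ℂ 𝔤) [H.IsCartanSubalgebra]
    (B : LinearMap.BilinForm ℂ 𝔤) (hB : EYM.IsInvariantInnerProduct B)
    (b : (LieAlgebra.IsKilling.rootSystem H).Base) (W₀ : H) (hW₀ : EYM.IsRegularA1Vector b W₀)
    (k : ℝ) (hk : k = 1 ∨ k = 0 ∨ k = -1) (ℓ : ℝ) (hℓ : 0 < ℓ) (rh : ℝ) (hrh : rh ≠ 0) :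
    -- existence, analyticity and uniqueness, for arbitrary data of a regular non-extremal horizon
    (∀ p₀ ∈ EYM.Admissible (EYM.couplings B W₀) k ℓ rh,
      ∃ U : Set (EYM.HorizonData (EYM.SigmaW W₀)), IsOpen U ∧ p₀ ∈ U ∧
        U ⊆ EYM.Admissible (EYM.couplings B W₀) k ℓ rh ∧
      ∃ ε : ℝ, 0 < ε ∧
      ∃ f : EYM.HorizonData (EYM.SigmaW W₀) → EYM.Fields (EYM.SigmaW W₀),
        -- the solutions are jointly analytic in the data and the radius
        (AnalyticOnNhd ℝ (fun q : EYM.HorizonData (EYM.SigmaW W₀) × ℝ => (f q.1).m q.2)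
            (U ×ˢ Ioo (rh - ε) (rh + ε)) ∧
          AnalyticOnNhd ℝ (fun q : EYM.HorizonData (EYM.SigmaW W₀) × ℝ => (f q.1).S q.2)
            (U ×ˢ Ioo (rh - ε) (rh + ε)) ∧
          (∀ j, AnalyticOnNhd ℝ (fun q : EYM.HorizonData (EYM.SigmaW W₀) × ℝ => (f q.1).ω j q.2)
            (U ×ˢ Ioo (rh - ε) (rh + ε))) ∧
          ∀ j, AnalyticOnNhd ℝ (fun q : EYM.HorizonData (EYM.SigmaW W₀) × ℝ => (f q.1).E j q.2)
            (U ×ˢ Ioo (rh - ε) (rh + ε))) ∧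
        ∀ p ∈ U,
          (∀ r ∈ Ioo (rh - ε) (rh + ε), r ≠ rh →
            EYM.SolvesAt (EYM.couplings B W₀) k ℓ (f p) r) ∧
          EYM.HorizonExpansion k ℓ rh (f p) p (EYM.muPrime (EYM.couplings B W₀) k ℓ rh p)
            (𝓝 rh) ∧
          -- uniqueness, on either side of the horizon
          ∀ s : Set ℝ, EYM.IsHorizonSide rh s → ∀ g : EYM.Fields (EYM.SigmaW W₀),
            (∀ r ∈ s, EYM.SolvesAt (EYM.couplings B W₀) k ℓ g r) →
            EYM.HorizonExpansion k ℓ rh g p (EYM.muPrime (EYM.couplings B W₀) k ℓ rh p)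
              (𝓝[s] rh) →
            ∀ r ∈ s ∩ Ioo (rh - ε) (rh + ε),
              g.m r = (f p).m r ∧ g.S r = (f p).S r ∧
              (∀ j, g.ω j r = (f p).ω j r) ∧ ∀ j, g.E j r = (f p).E j r) ∧
    -- the slope of the mass fraction at the horizon is forced
    (∀ p : EYM.HorizonData (EYM.SigmaW W₀), p.1 ≠ 0 → ∀ ν : ℝ, 0 < ν →
      ∀ s : Set ℝ, EYM.IsHorizonSide rh s → ∀ g : EYM.Fields (EYM.SigmaW W₀),
        (∀ r ∈ s, EYM.SolvesAt (EYM.couplings B W₀) k ℓ g r) →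
        EYM.HorizonExpansion k ℓ rh g p ν (𝓝[s] rh) →
        ν = EYM.muPrime (EYM.couplings B W₀) k ℓ rh p) := by
  refine ⟨fun p₀ hp₀ => EYM.exists_analytic_horizon_solution _ hℓ.ne' hrh hp₀, ?_⟩
  intro p hp ν hν s hs g hg hexp
  exact (hexp.tendsto_curve hℓ.ne' hrh hs hp hν.ne' hg).1
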